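/- For every constant $C>0$ there is a constant $c>0$ such that the following holds. Let $k$ be a non-negative integer and let $0.01\le \varepsilon_1<\varepsilon_2\le 0.49$ with $\varepsilon_2-\varepsilon_1\ge 2^{-Ck}$. Put $\ell'=\left\lfloor \frac{-\log_2(\varepsilon_2-\varepsilon_1)}{20}\right\rfloor$. Then, for all sufficiently large $n$ (depending on $k,\varepsilon_1,\varepsilon_2$), any $(k,k+\ell',\varepsilon_1,\varepsilon_2)$-tolerant junta tester for functions on $\{0,1\}^n$ must, on some input and some outcome of its random choices, make at least $$\left(\frac{k}{-\log_2(\varepsilon_2-\varepsilon_1)}\right)^{-c\,\log_2(\varepsilon_2-\varepsilon_1)}$$ queries. Here a function $g:\{0,1\}^n\to\{0,1\}$ is a $k$-junta if it depends on at most $k$ of its coordinates; $f$ is $\varepsilon$-close to $g$ if $f$ and $g$ disagree on at most $\varepsilon 2^n$ points, and $f$ is $\varepsilon$-far from $k'$-juntas if it is $\varepsilon$-close to no $k'$-junta. A $(k,k',\varepsilon_1,\varepsilon_2)$-tolerant junta tester is a randomized adaptive query algorithm, i.e. a probability distribution over deterministic decision trees that query values of the unknown function $f:\{0,1\}^n\to\{0,1\}$,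 which accepts with probability at least $2/3$ every $f$ that is $\varepsilon_1$-close to some $k$-junta and rejects with probability at least $2/3$ every $f$ that is $\varepsilon_2$-far from $k'$-juntas. -/

import Mathlib

namespace JuntaTesting

/-- Boolean functions on the cube `{0,1}^n`. -/
abbrev BoolFun (n : ℕ) : Type := (Fin n → Bool) → Bool

/-- `g` is a `k`-junta: its value depends on at most `k` of the `n` coordinates. -/
def IsJunta {n : ℕ} (k : ℕ) (g : BoolFun n) : Prop :=
  ∃ S : Finset (Fin n), S.card ≤ k ∧ DependsOn g (S : Set (Fin n))

/-- `f` and `g` disagree on at most `ε 2^n` points of the cube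
(`hammingDist f g` is the number of points `x` with `f x ≠ g x`). -/
def IsClose {n : ℕ} (ε : ℝ) (f g : BoolFun n) : Prop :=
  (hammingDist f g : ℝ) ≤ ε * 2 ^ n

/-- `f` is `ε`-close to some `k`-junta. -/
def CloseToJunta {n : ℕ} (k : ℕ) (ε : ℝ) (f : BoolFun n) : Prop :=
  ∃ g : BoolFun n, IsJunta k g ∧ IsClose ε f g

/-- `f` is `ε`-far from every `k`-junta. -/
def FarFromJuntas {n : ℕ} (k : ℕ) (ε : ℝ) (f : BoolFun n) : Prop :=
  ∀ g : BoolFun n, IsJunta k g → ¬ IsClose ε f g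

/-- Deterministic adaptive query algorithms for an unknown function on `{0,1}^n`: either stop with
an answer (`true` is "accept"), or query a point and continue according to the value received. -/
inductive DecisionTree (n : ℕ) : Type where
  | answer (b : Bool) : DecisionTree n
  | query (x : Fin n → Bool) (next : Bool → DecisionTree n) : DecisionTree n

namespace DecisionTree

/-- The answer given when the unknown function is `f`. -/
def eval {n : ℕ} (f : BoolFun n) : DecisionTree n → Bool
  | answer b => b
  | query x next => eval f (next (f x))

/-- The number of queries made when the unknown function is `f`. -/
def numQueries {n : ℕ} (f : BoolFun n) : DecisionTree n → ℕ
  | answer _ => 0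
  | query x next => numQueries f (next (f x)) + 1

end DecisionTree

/-- Randomized adaptive query algorithms: a random choice of a deterministic one. -/
abbrev RandomizedAlg (n : ℕ) : Type := PMF (DecisionTree n)

/-- The probability that the algorithm `T`, run on `f`, answers `b`. -/
noncomputable def RandomizedAlg.prob {n : ℕ} (T : RandomizedAlg n) (f : BoolFun n) (b : Bool) :
    ENNReal :=
  (T.map (DecisionTree.eval f)) b

/-- `T` is a `(k, k', ε₁, ε₂)`-tolerant junta tester for functions on `{0,1}^n`. -/
structure IsTolerantJuntaTester {n : ℕ} (k k' : ℕ) (ε₁ ε₂ : ℝ) (T : RandomizedAlg n) : Prop where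
  accepts : ∀ f : BoolFun n, CloseToJunta k ε₁ f → 2 / 3 ≤ RandomizedAlg.prob T f true
  rejects : ∀ f : BoolFun n, FarFromJuntas k' ε₂ f → 2 / 3 ≤ RandomizedAlg.prob T f false

end JuntaTesting

/-! The proof compares two random families that few queries cannot tell apart. The relevant
coordinates form a free block of size `a` and `L` blocks of size `s + 1`. Each block has one secret
coordinate, chosen by a uniform `d`. A NO function is uniformly random on the region where the free
block lies in `W`, and zero elsewhere. A YES function is also zero off that region; on it, it is a
random function of the free block, the visible coordinates and a colour `col` of the hidden string
in `{0,1}^L`.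

The colour classes are codes of minimum distance `r`. Distinct points share a projection only if
they differ exactly on hidden coordinates, in at least `r` blocks. Such a collision fixes `d` in `r`
blocks, so its probability is at most `(s + 1)^(-r)` (`frac_proj_eq_le`). Until a collision is met,
the two families answer identically (`frac_eval_le_add_of_collision_le`), so a tester needs about
`(s + 1)^(r/2)` queries.

By Chernoff and a union bound, a NO function errs on almost half of the region against every junta
(`frac_closeOn_le`). For YES, restricting to the most popular colour gives a junta on `a + L * s`
coordinates that is exact on that class and wrong on about half of the rest (`frac_not_closeOn_le`).
With `2 ^ (8 * r)` colours, the error proportions differ by about `2 ^ (-8r)`, and the size of `W`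
places the interval `[ε₁, ε₂]` inside this gap.

Taking `r` near a hundredth of the logarithm of the inverse gap gives the small-gap case. A single
colour with `r = 1` handles larger gaps. Where the claimed bound is at most 2, constants against
parities show that one query does not suffice. -/

namespace JuntaTesting

/-! ### Uniform probability as counting. -/

open scoped Classical in
/-- The proportion of the elements of a finite type which satisfy `p`. -/
noncomputable def frac {α : Type*} [Fintype α] (p : α → Prop) : ℝ :=
  ((Finset.univ.filter p).card : ℝ) / Fintype.card α

section frac

variable {α β : Type*} [Fintype α] [Fintype β]

lemma frac_nonneg (p : α → Prop) : 0 ≤ frac p := by unfold frac; positivity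

lemma frac_mono {p q : α → Prop} (h : ∀ x, p x → q x) : frac p ≤ frac q := by
  unfold frac
  gcongr
  exact h _

lemma frac_le_one (p : α → Prop) : frac p ≤ 1 := by
  unfold frac
  apply div_le_one_of_le₀ _ (by positivity)
  exact_mod_cast Finset.card_le_univ _

lemma frac_exists_le {κ : Type*} (s : Finset κ) (p : κ → α → Prop) :
    frac (fun x => ∃ i ∈ s, p i x) ≤ ∑ i ∈ s, frac (p i) := by
  classical
  unfold frac
  rw [← Finset.sum_div]
  gcongr
  rw [← Nat.cast_sum, Nat.cast_le]
  refine le_trans (Finset.card_le_card ?_) (Finset.card_biUnion_le (s := s))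
  intro x
  simp

lemma frac_split (p q : α → Prop) :
    frac p = frac (fun x => p x ∧ q x) + frac (fun x => p x ∧ ¬ q x) := by
  classical
  unfold frac
  rw [← add_div, ← Nat.cast_add]
  congr 2
  have h := Finset.card_filter_add_card_filter_not (s := Finset.univ.filter p) q
  rw [Finset.filter_filter, Finset.filter_filter] at h
  convert h.symm using 3 <;> (ext x; simp)

lemma frac_not [Nonempty α] (p : α → Prop) : frac (fun x => ¬ p x) = 1 - frac p := by
  have h := frac_split (fun _ : α => True) p
  have h1 : frac (fun _ : α => True) = 1 := by
    simp [frac]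
  simp only [true_and] at h
  linarith

lemma frac_comp_equiv (e : α ≃ β) (p : β → Prop) : frac (fun x => p (e x)) = frac p := by
  classical
  unfold frac
  rw [Fintype.card_congr e]
  congr 2
  exact Finset.card_bij (fun x _ => e x) (by simp) (by simp)
    (fun b hb => ⟨e.symm b, by simpa using hb, by simp⟩)

lemma frac_prod (p : α × β → Prop) :
    frac p = (∑ a, frac (fun b => p (a, b))) / Fintype.card α := by
  classical
  unfold frac
  rw [← Finset.sum_div, div_div, Fintype.card_prod, Nat.cast_mul, mul_comm (Fintype.card α : ℝ)]
  congr 1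
  simp only [Finset.card_filter, ← Nat.cast_sum]
  rw [Fintype.sum_prod_type]

lemma frac_prod' (p : α × β → Prop) :
    frac p = (∑ b, frac (fun a => p (a, b))) / Fintype.card β := by
  rw [← frac_prod (fun x : β × α => p (x.2, x.1)), ← frac_comp_equiv (Equiv.prodComm α β)]
  rfl

lemma frac_le_of_fiber_le [Nonempty α] (p : α × β → Prop) {c : ℝ}
    (h : ∀ a, frac (fun b => p (a, b)) ≤ c) : frac p ≤ c := by
  rw [frac_prod, div_le_iff₀ (by positivity)]
  calc _ ≤ ∑ _a : α, c := Finset.sum_le_sum fun a _ => h a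
    _ = _ := by simp [mul_comm]

/-- Markov's inequality. -/
lemma frac_mul_le_sum [Nonempty α] (p : α → Prop) (g : α → ℝ) {c : ℝ} (hg : ∀ x, 0 ≤ g x)
    (h : ∀ x, p x → c ≤ g x) : frac p * c ≤ (∑ x, g x) / Fintype.card α := by
  classical
  unfold frac
  rw [div_mul_eq_mul_div]
  gcongr
  rw [← nsmul_eq_mul, ← Finset.sum_const]
  exact le_trans (Finset.sum_le_sum fun x hx => h x (Finset.mem_filter.1 hx).2)
    (Finset.sum_le_sum_of_subset_of_nonneg (Finset.filter_subset _ _) fun x _ _ => hg x)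

end frac

/-! ### Random assignments and the Chernoff bound. -/

lemma frac_agree {ι β : Type*} [Fintype ι] [Fintype β] [Nonempty β] [DecidableEq ι]
    (S : Finset ι) (ρ : ι → β) :
    frac (fun H : ι → β => ∀ x ∈ S, H x = ρ x) = ((Fintype.card β : ℝ) ^ S.card)⁻¹ := by
  classical
  have h : (Finset.univ.filter fun H : ι → β => ∀ x ∈ S, H x = ρ x)
      = Fintype.piFinset (fun i => if i ∈ S then {ρ i} else Finset.univ) := by
    ext H
    simp only [Finset.mem_filter, Finset.mem_univ, true_and, Fintype.mem_piFinset]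
    refine forall_congr' fun i => ?_
    by_cases hi : i ∈ S <;> simp [hi]
  have hc : (Fintype.piFinset (fun i => if i ∈ S then {ρ i} else (Finset.univ : Finset β))).card
      * Fintype.card β ^ S.card = Fintype.card β ^ Fintype.card ι := by
    rw [Fintype.card_piFinset]
    have : ∀ i, (if i ∈ S then {ρ i} else (Finset.univ : Finset β)).card
        = if i ∈ S then 1 else Fintype.card β := by
      intro i; split_ifs <;> simp
    simp only [this]
    rw [Finset.prod_ite, Finset.prod_const_one, one_mul, Finset.prod_const, ← pow_add]
    congr 1
    have := Finset.card_filter_add_card_filter_not (s := (Finset.univ : Finset ι)) (· ∈ S)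
    simp at this ⊢
    omega
  unfold frac
  have hβ : (Fintype.card β : ℝ) ≠ 0 := by positivity
  have hc' : (((Finset.univ.filter fun H : ι → β => ∀ x ∈ S, H x = ρ x).card : ℝ))
      * (Fintype.card β : ℝ) ^ S.card = (Fintype.card β : ℝ) ^ Fintype.card ι := by
    rw [h]; exact_mod_cast hc
  rw [Fintype.card_fun, Nat.cast_pow, ← hc']
  have hne : (((Finset.univ.filter fun H : ι → β => ∀ x ∈ S, H x = ρ x).card : ℝ)) ≠ 0 := by
    intro h0
    rw [h0, zero_mul] at hc'
    exact pow_ne_zero _ hβ hc'.symm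
  rw [div_eq_iff (by positivity)]
  field_simp
  congr!

/-- While `π` separates the revealed points, their values under `H ∘ π` are independent and uniform,
just as for a random function on `X`. This settles the leaves in the lazy sampling argument. -/
lemma frac_agree_comp {X ι β : Type*} [Fintype ι] [Fintype β] [Nonempty β] [Nonempty X]
    [DecidableEq ι] (S : Finset X) (π : X → ι) (hπ : Set.InjOn π S) (ρ : X → β) :
    frac (fun H : ι → β => ∀ x ∈ S, H (π x) = ρ x) = ((Fintype.card β : ℝ) ^ S.card)⁻¹ := by
  rw [← Finset.card_image_of_injOn hπ,
    ← frac_agree (S.image π) (fun i => ρ (Function.invFunOn π S i))]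
  congr 1
  ext H
  simp only [Finset.mem_image, forall_exists_index, and_imp, forall_apply_eq_imp_iff₂]
  refine forall₂_congr fun x hx => ?_
  rw [hπ.leftInvOn_invFunOn hx]

/-- The sign of a bit. -/
def sgn (b : Bool) : ℝ := if b then 1 else -1

/-- The Chernoff bound for a weighted sum of independent random signs. -/
lemma frac_sum_sgn_ge_le {ι : Type*} [Fintype ι] [DecidableEq ι] (c : ι → ℝ) {τ V : ℝ}
    (hV : 0 < V) (hτ : 0 ≤ τ)
    (hc : ∑ i, c i ^ 2 ≤ V) :
    frac (fun σ : ι → Bool => τ ≤ ∑ i, c i * sgn (σ i)) ≤ Real.exp (-(τ ^ 2 / (2 * V))) := by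
  -- This `t` minimises the exponent `t ^ 2 * V / 2 - t * τ`.
  set t := τ / V with ht
  have ht0 : 0 ≤ t := by positivity
  have hsum : ∑ σ : ι → Bool, Real.exp (t * ∑ i, c i * sgn (σ i))
      = ∏ i, (2 * Real.cosh (t * c i)) := by
    have h1 : ∀ i, 2 * Real.cosh (t * c i) = ∑ b : Bool, Real.exp (t * (c i * sgn b)) := by
      intro i
      rw [Fintype.sum_bool, Real.cosh_eq]
      simp [sgn]
      ring
    simp only [h1]
    rw [Finset.prod_univ_sum]
    simp only [Fintype.piFinset_univ]
    refine Finset.sum_congr rfl fun σ _ => ?_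
    rw [Finset.mul_sum, Real.exp_sum]
  have hle : ∏ i, (2 * Real.cosh (t * c i)) ≤ 2 ^ Fintype.card ι * Real.exp (t ^ 2 * V / 2) := by
    rw [Finset.prod_mul_distrib, Finset.prod_const, Finset.card_univ]
    gcongr
    calc ∏ i, Real.cosh (t * c i) ≤ ∏ i, Real.exp ((t * c i) ^ 2 / 2) :=
          Finset.prod_le_prod (fun i _ => (Real.cosh_pos _).le) fun i _ => Real.cosh_le_exp_half_sq _
      _ = Real.exp (t ^ 2 * (∑ i, c i ^ 2) / 2) := by
          rw [← Real.exp_sum, ← Finset.sum_div, Finset.mul_sum]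
          simp only [mul_pow]
      _ ≤ _ := by gcongr
  have hmarkov := frac_mul_le_sum (fun σ : ι → Bool => τ ≤ ∑ i, c i * sgn (σ i))
    (fun σ => Real.exp (t * ∑ i, c i * sgn (σ i))) (c := Real.exp (t * τ))
    (fun _ => (Real.exp_pos _).le) (fun σ hσ => by gcongr)
  have hexp : Real.exp (-(τ ^ 2 / (2 * V))) * Real.exp (t * τ) = Real.exp (t ^ 2 * V / 2) := by
    rw [← Real.exp_add]
    congr 1
    rw [ht]; field_simp; ring
  refine le_of_mul_le_mul_right (hmarkov.trans ?_) (Real.exp_pos (t * τ))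
  rw [hexp, hsum, Fintype.card_fun, Fintype.card_bool, div_le_iff₀ (by positivity)]
  push_cast
  rwa [mul_comm (Real.exp _)]

/-! ### Colouring the cube by codes. -/

/-- Greedy colouring. -/
lemma exists_greedy_coloring {α : Type*} [Fintype α] [DecidableEq α] (R : α → α → Prop)
    [DecidableRel R]
    (hsymm : ∀ x y, R x y → R y x) {M : ℕ}
    (hM : ∀ x, (Finset.univ.filter fun y => R x y ∧ y ≠ x).card < M) :
    ∃ col : α → Fin M, ∀ x y, x ≠ y → R x y → col x ≠ col y := by
  classical
  suffices h : ∀ s : Finset α, ∃ col : α → Fin M,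
      ∀ x ∈ s, ∀ y ∈ s, x ≠ y → R x y → col x ≠ col y by
    obtain ⟨col, h⟩ := h Finset.univ
    exact ⟨col, fun x y => h x (Finset.mem_univ _) y (Finset.mem_univ _)⟩
  intro s
  induction s using Finset.induction_on with
  | empty =>
    rcases isEmpty_or_nonempty α with hα | ⟨⟨x⟩⟩
    · exact ⟨fun x => (hα.false x).elim, by simp⟩
    · exact ⟨fun _ => ⟨0, (Nat.zero_le _).trans_lt (hM x)⟩, by simp⟩
  | insert a s ha ih =>
    obtain ⟨col, hcol⟩ := ih
    obtain ⟨m, hm⟩ : ∃ m, m ∉ (Finset.univ.filter fun y => R a y ∧ y ≠ a).image col := by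
      by_contra! hall
      have h1 : (Finset.univ : Finset (Fin M)).card ≤
          ((Finset.univ.filter fun y => R a y ∧ y ≠ a).image col).card :=
        Finset.card_le_card fun m _ => hall m
      have h2 := Finset.card_image_le (s := Finset.univ.filter fun y => R a y ∧ y ≠ a) (f := col)
      have h3 := hM a
      simp only [Finset.card_univ, Fintype.card_fin] at h1
      omega
    have hm' : ∀ y, R a y → y ≠ a → col y ≠ m := by
      intro y h1 h2 h3
      exact hm (Finset.mem_image.2 ⟨y, by simp [h1, h2], h3⟩)
    refine ⟨Function.update col a m, ?_⟩
    intro x hx y hy hxy hR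
    by_cases hxa : x = a
    · subst hxa
      rw [Function.update_self, Function.update_of_ne hxy.symm]
      exact (hm' y hR hxy.symm).symm
    · by_cases hya : y = a
      · subst hya
        rw [Function.update_self, Function.update_of_ne hxa]
        exact hm' x (hsymm _ _ hR) hxa
      · rw [Function.update_of_ne hxa, Function.update_of_ne hya]
        exact hcol x (Finset.mem_of_mem_insert_of_ne hx hxa) y
          (Finset.mem_of_mem_insert_of_ne hy hya) hxy hR

/-- The size of a Hamming ball, bounded through its generating function. -/
lemma card_hammingBall_le (L r : ℕ) (y : Fin L → Bool) :
    ((Finset.univ.filter fun y' : Fin L → Bool => hammingDist y y' < r).card : ℝ)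
      ≤ 16 ^ r * (17 / 16) ^ L := by
  have hgen : ∑ y' : Fin L → Bool, ((1 : ℝ) / 16) ^ hammingDist y y' = (17 / 16) ^ L := by
    have h1 : ∀ i : Fin L, ∑ b : Bool, (if y i ≠ b then (1 : ℝ) / 16 else 1) = 17 / 16 := by
      intro i
      rw [Fintype.sum_bool]
      cases y i <;> norm_num
    have h2 : ∏ i : Fin L, ∑ b : Bool, (if y i ≠ b then (1 : ℝ) / 16 else 1) = (17 / 16) ^ L := by
      simp only [h1, Finset.prod_const, Finset.card_univ, Fintype.card_fin]
    rw [← h2, Finset.prod_univ_sum]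
    simp only [Fintype.piFinset_univ]
    refine Finset.sum_congr rfl fun y' _ => ?_
    rw [Finset.prod_ite, Finset.prod_const_one, mul_one, Finset.prod_const]
    rfl
  have hcount : ((Finset.univ.filter fun y' : Fin L → Bool => hammingDist y y' < r).card : ℝ)
      * (1 / 16) ^ r ≤ (17 / 16) ^ L := by
    rw [← hgen, ← nsmul_eq_mul, ← Finset.sum_const]
    refine le_trans (Finset.sum_le_sum (g := fun y' => ((1 : ℝ) / 16) ^ hammingDist y y') ?_)
      (Finset.sum_le_sum_of_subset_of_nonneg (Finset.filter_subset _ _)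
        fun _ _ _ => by positivity)
    intro y' hy
    exact pow_le_pow_of_le_one (by norm_num) (by norm_num) (Finset.mem_filter.1 hy).2.le
  calc _ = ((Finset.univ.filter fun y' : Fin L → Bool => hammingDist y y' < r).card : ℝ)
      * (1 / 16) ^ r * 16 ^ r := by
        rw [mul_assoc, ← mul_pow]; norm_num
    _ ≤ (17 / 16) ^ L * 16 ^ r := by gcongr
    _ = _ := mul_comm _ _

/-- Joining points at distance below `r` gives a graph whose degrees are less than the size of a
Hamming ball, so greedy colouring needs no more colours than that. The length `44 * r` fits because
`16 * (17/16)^44 ≤ 2^8`. -/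
lemma exists_coloring_of_code (r : ℕ) :
    ∃ col : (Fin (44 * r) → Bool) → Fin (2 ^ (8 * r)),
      ∀ y y', col y = col y' → y ≠ y' → r ≤ hammingDist y y' := by
  obtain ⟨col, h⟩ := exists_greedy_coloring (M := 2 ^ (8 * r))
    (fun y y' : Fin (44 * r) → Bool => hammingDist y y' < r)
    (fun x y h => by rwa [hammingDist_comm]) (fun y => by
      have hball := card_hammingBall_le (44 * r) r y
      have hnum : (16 : ℝ) ^ r * (17 / 16) ^ (44 * r) ≤ 2 ^ (8 * r) := by
        rw [pow_mul, pow_mul, ← mul_pow]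
        gcongr
        norm_num
      have hle : (Finset.univ.filter fun y' : Fin (44 * r) → Bool => hammingDist y y' < r).card
          ≤ 2 ^ (8 * r) := by exact_mod_cast hball.trans hnum
      rcases Nat.eq_zero_or_pos r with rfl | hr
      · simp
      refine lt_of_lt_of_le (Finset.card_lt_card ?_) hle
      -- The centre lies in the ball but is not its own neighbour, which makes the inequality
      -- strict.
      refine (Finset.ssubset_iff_of_subset ?_).2 ⟨y, by simp [hr], by simp⟩
      intro y' hy
      simp only [Finset.mem_filter] at hy ⊢
      exact ⟨hy.1, hy.2.1⟩)
  exact ⟨col, fun y y' h1 h2 => by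
    by_contra h3
    exact h y y' h2 (not_le.1 h3) h1⟩

/-! ### Decision trees and lazy sampling. -/

namespace DecisionTree

variable {n : ℕ}

/-- The set of points queried when the unknown function is `f`. -/
def queried (f : BoolFun n) : DecisionTree n → Finset (Fin n → Bool)
  | answer _ => ∅
  | query x next => insert x (queried f (next (f x)))

lemma card_queried_le (f : BoolFun n) (t : DecisionTree n) :
    (t.queried f).card ≤ t.numQueries f := by
  induction t with
  | answer b => simp [queried, numQueries]
  | query x next ih =>
    exact (Finset.card_insert_le _ _).trans (Nat.succ_le_succ (ih _))

end DecisionTree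

/-- The two points `x ≠ y` of `Q` are not separated by `π`. -/
def HasCollision {X ι : Type*} (π : X → ι) (Q : Finset X) : Prop :=
  ∃ x ∈ Q, ∃ y ∈ Q, x ≠ y ∧ π x = π y

lemma HasCollision.mono {X ι : Type*} {π : X → ι} {Q Q' : Finset X} (h : Q ⊆ Q')
    (hc : HasCollision π Q) : HasCollision π Q' :=
  let ⟨x, hx, y, hy, hxy⟩ := hc
  ⟨x, h hx, y, h hy, hxy⟩

section coupling

variable {n : ℕ} {X ι : Type*} [Fintype X] [DecidableEq X] [Fintype ι] [DecidableEq ι]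

/-- The function on the cube `{0,1}^n` obtained from `F` through `res`, made zero outside of the
region `W`. -/
def gated (W : X → Bool) (res : (Fin n → Bool) → X) (F : X → Bool) : BoolFun n :=
  fun p => W (res p) && F (res p)

/-- Lazy sampling: a decision tree sees the same distribution on a uniformly random function `F` as
on a uniformly random function which factors through `π`, until it meets a collision of `π`.  Here
the values on `S` have been revealed already. -/
lemma frac_eval_le_add_frac_collision_aux (W : X → Bool) (res : (Fin n → Bool) → X) (π : X → ι)
    (v : Bool) (t : DecisionTree n) :
    ∀ (S : Finset X) (ρ : X → Bool), Set.InjOn π S →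
    frac (fun F : X → Bool => (∀ x ∈ S, F x = ρ x) ∧ t.eval (gated W res F) = v)
      ≤ frac (fun H : ι → Bool => (∀ x ∈ S, H (π x) = ρ x) ∧
          t.eval (gated W res (H ∘ π)) = v)
        + frac (fun F : X → Bool => (∀ x ∈ S, F x = ρ x) ∧
          HasCollision π (S ∪ (t.queried (gated W res F)).image res)) := by
  induction t with
  | answer b =>
    intro S ρ hS
    by_cases hX : Nonempty X
    · by_cases hb : b = v
      · simp only [DecisionTree.eval, hb, and_true]
        rw [frac_agree, frac_agree_comp S π hS]
        exact le_add_of_nonneg_right (frac_nonneg _)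
      · have h0 : frac (fun F : X → Bool => (∀ x ∈ S, F x = ρ x) ∧
            (DecisionTree.answer b : DecisionTree n).eval (gated W res F) = v) = 0 := by
          simp [frac, DecisionTree.eval, hb]
        rw [h0]
        exact add_nonneg (frac_nonneg _) (frac_nonneg _)
    · exact (hX ⟨res fun _ => false⟩).elim
  | query p next ih =>
    intro S ρ hS
    have hsub : ∀ F : X → Bool, ((next (gated W res F p)).queried (gated W res F)).image res ⊆
        ((DecisionTree.query p next).queried (gated W res F)).image res :=
      fun F => Finset.image_subset_image (Finset.subset_insert _ _)
    -- The answer is already forced here: the point lies outside the region or its value has been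
    -- revealed.
    by_cases hdet : W (res p) = false ∨ res p ∈ S
    · obtain ⟨w, hw⟩ : ∃ w, w = (W (res p) && ρ (res p)) := ⟨_, rfl⟩
      have hF : ∀ F : X → Bool, (∀ x ∈ S, F x = ρ x) → gated W res F p = w := by
        intro F h
        rcases hdet with h' | h'
        · simp [gated, hw, h']
        · simp [gated, hw, h _ h']
      have hH : ∀ H : ι → Bool, (∀ x ∈ S, H (π x) = ρ x) → gated W res (H ∘ π) p = w :=
        fun H h => hF (H ∘ π) h
      refine le_trans (frac_mono ?_) ((ih w S ρ hS).trans (add_le_add (frac_mono ?_)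
        (frac_mono ?_)))
      · rintro F ⟨h1, h2⟩
        exact ⟨h1, by rw [← hF F h1]; exact h2⟩
      · rintro H ⟨h1, h2⟩
        refine ⟨h1, ?_⟩
        rw [← hH H h1] at h2
        exact h2
      · rintro F ⟨h1, h2⟩
        refine ⟨h1, ?_⟩
        rw [← hF F h1] at h2
        exact h2.mono (Finset.union_subset_union_right (hsub F))
    · push Not at hdet
      obtain ⟨hW, hpS⟩ := hdet
      have hW : W (res p) = true := by simpa using hW
      -- If the new point collides with a revealed one, every `F` consistent with `ρ` is counted in
      -- the collision term, which alone suffices.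
      by_cases hcol : ∃ y ∈ S, π y = π (res p)
      · obtain ⟨y, hy, hyp⟩ := hcol
        refine le_trans (frac_mono ?_) (le_add_of_nonneg_left (frac_nonneg _))
        rintro F ⟨h1, -⟩
        refine ⟨h1, y, Finset.mem_union_left _ hy, res p, Finset.mem_union_right _
          (Finset.mem_image_of_mem _ (Finset.mem_insert_self _ _)), ?_, hyp⟩
        rintro rfl
        exact hpS hy
      · push Not at hcol
        have hS' : Set.InjOn π (insert (res p) S : Finset X) := by
          rw [Finset.coe_insert, Set.injOn_insert (by simpa using hpS)]
          refine ⟨hS, ?_⟩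
          rintro ⟨y, hy, h⟩
          exact hcol y hy h
        have hupd : ∀ (w : Bool) (G : X → Bool),
            (∀ x ∈ insert (res p) S, G x = Function.update ρ (res p) w x) ↔
              (∀ x ∈ S, G x = ρ x) ∧ G (res p) = w := by
          intro w G
          rw [Finset.forall_mem_insert, Function.update_self, and_comm]
          refine and_congr_left fun _ => forall₂_congr fun x hx => ?_
          rw [Function.update_of_ne]
          rintro rfl
          exact hpS hx
        -- A fresh point: fix the answer `w` on both sides and apply induction with this point added
        -- to `S`. The two values of `w` are summed at the end.
        have key : ∀ w : Bool,
            frac (fun F : X → Bool => ((∀ x ∈ S, F x = ρ x) ∧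
              (DecisionTree.query p next).eval (gated W res F) = v) ∧ F (res p) = w)
            ≤ frac (fun H : ι → Bool => ((∀ x ∈ S, H (π x) = ρ x) ∧
              (DecisionTree.query p next).eval (gated W res (H ∘ π)) = v) ∧ H (π (res p)) = w)
            + frac (fun F : X → Bool => ((∀ x ∈ S, F x = ρ x) ∧ HasCollision π
              (S ∪ ((DecisionTree.query p next).queried (gated W res F)).image res)) ∧
                F (res p) = w) := by
          intro w
          have hF : ∀ F : X → Bool, F (res p) = w → gated W res F p = w := by
            intro F h; simp [gated, hW, h]
          refine le_trans (frac_mono ?_) ((ih w _ (Function.update ρ (res p) w) hS').trans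
            (add_le_add (frac_mono ?_) (frac_mono ?_)))
          · rintro F ⟨⟨h1, h2⟩, h3⟩
            refine ⟨(hupd w F).2 ⟨h1, h3⟩, ?_⟩
            have h4 : (next (gated W res F p)).eval (gated W res F) = v := h2
            rwa [hF F h3] at h4
          · rintro H ⟨h1, h2⟩
            obtain ⟨h1, h3⟩ := (hupd w (H ∘ π)).1 h1
            refine ⟨⟨h1, ?_⟩, h3⟩
            change (next (gated W res (H ∘ π) p)).eval (gated W res (H ∘ π)) = v
            rwa [hF (H ∘ π) h3]
          · rintro F ⟨h1, h2⟩
            obtain ⟨h1, h3⟩ := (hupd w F).1 h1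
            refine ⟨⟨h1, h2.mono ?_⟩, h3⟩
            have h4 := hsub F
            rw [hF F h3] at h4
            rw [Finset.insert_union]
            refine Finset.insert_subset (Finset.mem_union_right _
              (Finset.mem_image_of_mem _ (Finset.mem_insert_self _ _)))
              (Finset.union_subset_union_right h4)
        have hnot : ∀ b : Bool, ¬ b = true ↔ b = false := by simp
        rw [frac_split _ (fun F : X → Bool => F (res p) = true),
          frac_split (fun H : ι → Bool => _ ∧ _) (fun H : ι → Bool => H (π (res p)) = true),
          frac_split (fun F : X → Bool => _ ∧ HasCollision _ _)
            (fun F : X → Bool => F (res p) = true)]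
        simp only [hnot]
        have := key true
        have := key false
        linarith

lemma frac_eval_le_add_frac_collision (W : X → Bool) (res : (Fin n → Bool) → X) (π : X → ι)
    (v : Bool) (t : DecisionTree n) :
    frac (fun F : X → Bool => t.eval (gated W res F) = v)
      ≤ frac (fun H : ι → Bool => t.eval (gated W res (H ∘ π)) = v)
        + frac (fun F : X → Bool =>
          HasCollision π ((t.queried (gated W res F)).image res)) := by
  simpa using frac_eval_le_add_frac_collision_aux W res π v t ∅ (fun _ => false) (by simp)

/-- The coupling, averaged over a random choice of `π`. -/
lemma frac_eval_le_add_of_collision_le {Δ : Type*} [Fintype Δ] [Nonempty Δ] (W : X → Bool)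
    (res : (Fin n → Bool) → X)
    (π : Δ → X → ι) (v : Bool) (t : DecisionTree n) {q : ℕ} (hq : ∀ f, t.numQueries f ≤ q)
    {γ : ℝ} (hγ0 : 0 ≤ γ) (hγ : ∀ x y : X, x ≠ y → frac (fun d => π d x = π d y) ≤ γ) :
    frac (fun F : X → Bool => t.eval (gated W res F) = v)
      ≤ frac (fun z : Δ × (ι → Bool) => t.eval (gated W res (z.2 ∘ π z.1)) = v)
        + q ^ 2 * γ := by
  have hbad : frac (fun z : (X → Bool) × Δ =>
      HasCollision (π z.2) ((t.queried (gated W res z.1)).image res)) ≤ q ^ 2 * γ := by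
    -- For fixed `F` the queried set does not depend on `d`, so a union bound over its pairs
    -- applies.
    refine frac_le_of_fiber_le _ fun F => ?_
    set Q := (t.queried (gated W res F)).image res with hQ
    have hQc : Q.card ≤ q :=
      Finset.card_image_le.trans ((t.card_queried_le _).trans (hq _))
    calc frac (fun d => HasCollision (π d) Q)
        ≤ frac (fun d => ∃ z ∈ (Q ×ˢ Q).filter (fun z => z.1 ≠ z.2), π d z.1 = π d z.2) := by
          refine frac_mono ?_
          rintro d ⟨x, hx, y, hy, hxy, h⟩
          exact ⟨(x, y), by simp [hx, hy, hxy], h⟩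
      _ ≤ ∑ z ∈ (Q ×ˢ Q).filter (fun z => z.1 ≠ z.2), frac (fun d => π d z.1 = π d z.2) :=
          frac_exists_le _ _
      _ ≤ ∑ z ∈ (Q ×ˢ Q).filter (fun z => z.1 ≠ z.2), γ :=
          Finset.sum_le_sum fun z hz => hγ _ _ (Finset.mem_filter.1 hz).2
      _ = ((Q ×ˢ Q).filter (fun z => z.1 ≠ z.2)).card * γ := by
          rw [Finset.sum_const, nsmul_eq_mul]
      _ ≤ q ^ 2 * γ := by
          gcongr
          have h1 := Finset.card_filter_le (Q ×ˢ Q) (fun z => z.1 ≠ z.2)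
          rw [Finset.card_product] at h1
          have h2 : Q.card * Q.card ≤ q ^ 2 := by rw [sq]; gcongr
          exact_mod_cast h1.trans h2
  rw [frac_prod'] at hbad
  rw [frac_prod]
  have hpos : (0 : ℝ) < Fintype.card Δ := by positivity
  refine le_trans ?_ (add_le_add_right hbad _)
  rw [← add_div, ← Finset.sum_add_distrib, le_div_iff₀ hpos, mul_comm, ← nsmul_eq_mul,
    ← Finset.card_univ, ← Finset.sum_const]
  exact Finset.sum_le_sum fun d _ => frac_eval_le_add_frac_collision W res (π d) v t

end coupling

/-! ### Juntas: irrelevant coordinates, and random functions far from them. -/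

section juntas

variable {V : Type*}

/-- `f` disagrees on at most `ε 2^|V|` points with a function which depends on at most `k`
coordinates. -/
def CloseOn [Fintype V] [DecidableEq V] (k : ℕ) (ε : ℝ) (f : (V → Bool) → Bool) : Prop :=
  ∃ g : (V → Bool) → Bool, (∃ S : Finset V, S.card ≤ k ∧ DependsOn g (S : Set V)) ∧
    (hammingDist f g : ℝ) ≤ ε * 2 ^ Fintype.card V

lemma sum_hammingDist_slices {A B C β : Type*} [Fintype A] [Fintype B] [Fintype C] [DecidableEq β]
    (E : A × B ≃ C) (F G : C → β) :
    ∑ b, hammingDist (fun a => F (E (a, b))) (fun a => G (E (a, b))) = hammingDist F G := by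
  simp only [hammingDist, Finset.card_filter]
  rw [← Fintype.sum_prod_type_right (fun z : A × B => if F (E z) ≠ G (E z) then 1 else 0),
    E.sum_comp (fun c => if F c ≠ G c then 1 else 0)]

/-- Splitting the coordinates of a cube. -/
def splitCube {n m : ℕ} (e : V ⊕ Fin m ≃ Fin n) :
    (V → Bool) × (Fin m → Bool) ≃ (Fin n → Bool) :=
  (Equiv.sumArrowEquivProdArrow V (Fin m) Bool).symm.trans (e.arrowCongr (Equiv.refl Bool))

lemma splitCube_inl {n m : ℕ} (e : V ⊕ Fin m ≃ Fin n) (z : (V → Bool) × (Fin m → Bool)) (v : V) :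
    splitCube e z (e (Sum.inl v)) = z.1 v := by
  simp [splitCube, Equiv.arrowCongr, Equiv.sumArrowEquivProdArrow]

lemma splitCube_inr {n m : ℕ} (e : V ⊕ Fin m ≃ Fin n) (z : (V → Bool) × (Fin m → Bool))
    (i : Fin m) : splitCube e z (e (Sum.inr i)) = z.2 i := by
  simp [splitCube, Equiv.arrowCongr, Equiv.sumArrowEquivProdArrow]

lemma card_add_of_equiv [Fintype V] {n m : ℕ} (e : V ⊕ Fin m ≃ Fin n) : Fintype.card V + m = n := by
  simpa using Fintype.card_congr e

variable [Fintype V] [DecidableEq V]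

lemma CloseOn.closeToJunta {n m k : ℕ} {ε : ℝ} (e : V ⊕ Fin m ≃ Fin n) {f : (V → Bool) → Bool}
    (h : CloseOn k ε f) : CloseToJunta k ε (fun p : Fin n → Bool => f (fun v => p (e (.inl v)))) := by
  obtain ⟨g, ⟨S, hS, hg⟩, hd⟩ := h
  refine ⟨fun p => g (fun v => p (e (.inl v))), ⟨S.image (fun v => e (.inl v)),
    Finset.card_image_le.trans hS, ?_⟩, ?_⟩
  · intro x y hxy
    refine hg fun v hv => hxy _ ?_
    exact Finset.mem_coe.2 (Finset.mem_image_of_mem _ hv)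
  · unfold IsClose
    rw [← sum_hammingDist_slices (splitCube e)]
    simp only [splitCube_inl]
    rw [Finset.sum_const, Finset.card_univ, Fintype.card_fun, Fintype.card_bool, Fintype.card_fin,
      ← card_add_of_equiv e, pow_add, nsmul_eq_mul]
    push_cast
    nlinarith [pow_pos (two_pos : (0 : ℝ) < 2) m]

/-- Fixing the padding coordinates of a junta leaves a junta. If it were close to the padded
function, then by averaging some slice would be at least as close to `f`. -/
lemma farFromJuntas_of_not_closeOn {n m k : ℕ} {ε : ℝ} (e : V ⊕ Fin m ≃ Fin n)
    {f : (V → Bool) → Bool} (h : ¬ CloseOn k ε f) :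
    FarFromJuntas k ε (fun p : Fin n → Bool => f (fun v => p (e (.inl v)))) := by
  rintro g ⟨S, hS, hg⟩ hd
  apply h
  unfold IsClose at hd
  rw [← sum_hammingDist_slices (splitCube e)] at hd
  simp only [splitCube_inl] at hd
  push_cast at hd
  obtain ⟨b, -, hb⟩ := Finset.exists_le_of_sum_le (s := (Finset.univ : Finset (Fin m → Bool)))
    (f := fun b => (hammingDist (fun a => f fun v => a v) (fun a => g (splitCube e (a, b))) : ℝ))
    (g := fun _ => ε * 2 ^ Fintype.card V) Finset.univ_nonempty (by
      refine hd.trans (le_of_eq ?_)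
      rw [Finset.sum_const, Finset.card_univ, Fintype.card_fun, Fintype.card_bool,
        Fintype.card_fin, ← card_add_of_equiv e, pow_add, nsmul_eq_mul]
      push_cast
      ring)
  refine ⟨fun a => g (splitCube e (a, b)),
    ⟨S.preimage (fun v => e (.inl v)) (fun x _ y _ hxy => by simpa using hxy), ?_, ?_⟩, hb⟩
  · refine le_trans ?_ hS
    exact Finset.card_le_card_of_injOn (fun v => e (.inl v)) (fun v hv => by
      have h1 := Finset.mem_preimage.1 (Finset.mem_coe.1 hv)
      exact Finset.mem_coe.2 h1)
      (fun x _ y _ hxy => by simpa using hxy)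
  · intro x y hxy
    refine hg fun i hi => ?_
    obtain ⟨j, rfl⟩ := e.surjective i
    rcases j with v | j
    · rw [splitCube_inl, splitCube_inl]
      exact hxy v (Finset.mem_coe.2 (Finset.mem_preimage.2 hi))
    · rw [splitCube_inr, splitCube_inr]

/-- A random function on a region of the cube is far from juntas. -/
lemma frac_closeOn_le (W : (V → Bool) → Bool) {k K : ℕ} {ε β : ℝ} (hβ : 0 ≤ β) (hK : 0 < K)
    (hW : (Finset.univ.filter fun x => W x = true).card = K)
    (hε : ε * 2 ^ Fintype.card V ≤ K * (1 / 2 - β)) :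
    frac (fun F : (V → Bool) → Bool => CloseOn k ε (fun x => W x && F x))
      ≤ 2 ^ Fintype.card V * 2 ^ (2 ^ k) * Real.exp (-(2 * β ^ 2 * K)) := by
  classical
  let I := Σ S : {S : Finset V // S.card ≤ k}, ((S.1 → Bool) → Bool)
  -- Closeness to the junta `i` means a large correlation of `F` with its signs on the region.
  let c : I → (V → Bool) → ℝ := fun i x => if W x then sgn (i.2 fun j => x j) else 0
  have hKR : (0 : ℝ) < K := by exact_mod_cast hK
  have hcsq : ∀ i, ∑ x, c i x ^ 2 = K := by
    intro i
    rw [← hW, Finset.card_filter]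
    push_cast
    refine Finset.sum_congr rfl fun x _ => ?_
    simp only [c, sgn]
    split_ifs <;> norm_num
  have hone : ∀ i, frac (fun F : (V → Bool) → Bool => 2 * β * K ≤ ∑ x, c i x * sgn (F x))
      ≤ Real.exp (-(2 * β ^ 2 * K)) := by
    intro i
    refine (frac_sum_sgn_ge_le (c i) hKR (by positivity) (hcsq i).le).trans (le_of_eq ?_)
    congr 2
    field_simp
  have hcard : (Fintype.card I : ℝ) ≤ 2 ^ Fintype.card V * 2 ^ (2 ^ k) := by
    have h1 : Fintype.card I ≤ 2 ^ Fintype.card V * 2 ^ (2 ^ k) := by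
      rw [Fintype.card_sigma]
      calc ∑ S : {S : Finset V // S.card ≤ k}, Fintype.card ((S.1 → Bool) → Bool)
          ≤ ∑ S : {S : Finset V // S.card ≤ k}, 2 ^ (2 ^ k) := by
            refine Finset.sum_le_sum fun S _ => ?_
            simp only [Fintype.card_fun, Fintype.card_bool, Fintype.card_coe]
            exact Nat.pow_le_pow_right two_pos (Nat.pow_le_pow_right two_pos S.2)
        _ ≤ _ := by
            rw [Finset.sum_const, Finset.card_univ, smul_eq_mul]
            gcongr
            refine (Fintype.card_subtype_le _).trans ?_
            simp
    exact_mod_cast h1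
  calc frac (fun F : (V → Bool) → Bool => CloseOn k ε (fun x => W x && F x))
      ≤ frac (fun F : (V → Bool) → Bool =>
          ∃ i ∈ (Finset.univ : Finset I), 2 * β * K ≤ ∑ x, c i x * sgn (F x)) := by
        refine frac_mono ?_
        rintro F ⟨g, ⟨S, hS, hg⟩, hd⟩
        obtain ⟨G, rfl⟩ := dependsOn_iff_exists_comp.1 hg
        refine ⟨⟨⟨S, hS⟩, G⟩, Finset.mem_univ _, ?_⟩
        -- On the region this is an equality between agreement and correlation. Off it, an error of
        -- the junta only lowers the left side.
        have hpt : ∀ x : V → Bool, (if W x = true then (1 : ℝ) else 0)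
            - 2 * (if (W x && F x) ≠ G (fun j => x j) then 1 else 0)
            ≤ c ⟨⟨S, hS⟩, G⟩ x * sgn (F x) := by
          have aux : ∀ w f g : Bool, (if w = true then (1 : ℝ) else 0)
              - 2 * (if (w && f) ≠ g then 1 else 0) ≤ (if w then sgn g else 0) * sgn f := by
            intro w f g
            cases w <;> cases f <;> cases g <;> norm_num [sgn]
          exact fun x => aux _ _ _
        have hsum := Finset.sum_le_sum fun x (_ : x ∈ Finset.univ) => hpt x
        rw [Finset.sum_sub_distrib, ← Finset.mul_sum] at hsum
        have e1 : ∑ x : V → Bool, (if W x = true then (1 : ℝ) else 0) = K := by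
          rw [← hW, Finset.card_filter]; push_cast; rfl
        have e2 : ∑ x : V → Bool, (if (W x && F x) ≠ G (fun j => x j) then (1 : ℝ) else 0)
            = hammingDist (fun x => W x && F x) (G ∘ (S : Set V).domRestrict) := by
          rw [hammingDist, Finset.card_filter]; push_cast; rfl
        rw [e1, e2] at hsum
        nlinarith
    _ ≤ ∑ i : I, frac (fun F : (V → Bool) → Bool => 2 * β * K ≤ ∑ x, c i x * sgn (F x)) :=
        frac_exists_le _ _
    _ ≤ ∑ i : I, Real.exp (-(2 * β ^ 2 * K)) := Finset.sum_le_sum fun i _ => hone i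
    _ ≤ _ := by
        rw [Finset.sum_const, Finset.card_univ, nsmul_eq_mul]
        gcongr

end juntas

/-! ### Hidden coordinates and functions of the hidden colour. -/

section hidden

variable {a L s : ℕ} {κ : Type*}

/-- The part of `x` in the free block, the visible part of the other blocks, and the part on the
hidden coordinates `(i, d i)`. -/
def parts (d : Fin L → Fin (s + 1)) (x : Fin a ⊕ Fin L × Fin (s + 1) → Bool) :
    (Fin a → Bool) × (Fin L × Fin s → Bool) × (Fin L → Bool) :=
  (fun i => x (.inl i), fun p => x (.inr (p.1, (d p.1).succAbove p.2)), fun i => x (.inr (i, d i)))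

lemma parts_injective (d : Fin L → Fin (s + 1)) : Function.Injective (parts (a := a) d) := by
  intro x y h
  simp only [parts, Prod.mk.injEq, funext_iff] at h
  obtain ⟨h1, h2, h3⟩ := h
  funext v
  rcases v with i | ⟨i, j⟩
  · exact h1 i
  · rcases Fin.eq_self_or_eq_succAbove (d i) j with rfl | ⟨j', rfl⟩
    · exact h3 i
    · exact h2 (i, j')

/-- `parts` as an equivalence. -/
noncomputable def partsEquiv (d : Fin L → Fin (s + 1)) :
    (Fin a ⊕ Fin L × Fin (s + 1) → Bool) ≃
      (Fin a → Bool) × (Fin L × Fin s → Bool) × (Fin L → Bool) :=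
  Equiv.ofBijective (parts d) <| (Fintype.bijective_iff_injective_and_card _).2
    ⟨parts_injective d, by simp [pow_add, pow_mul, mul_add]⟩

/-- The hidden part is replaced by its colour. -/
def proj (col : (Fin L → Bool) → κ) (d : Fin L → Fin (s + 1))
    (x : Fin a ⊕ Fin L × Fin (s + 1) → Bool) : (Fin a → Bool) × (Fin L × Fin s → Bool) × κ :=
  ((parts d x).1, (parts d x).2.1, col (parts d x).2.2)

/-- Equal projections force `x` and `y` to agree off the hidden coordinates, while their hidden
strings, distinct but of the same colour, differ in at least `r` places. Each block where the points
differ thus pins `d i` to a single value. -/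
lemma frac_proj_eq_le {r : ℕ} {col : (Fin L → Bool) → κ}
    (hcol : ∀ y y', col y = col y' → y ≠ y' → r ≤ hammingDist y y')
    (x y : Fin a ⊕ Fin L × Fin (s + 1) → Bool) (hxy : x ≠ y) :
    frac (fun d => proj col d x = proj col d y) ≤ (((s : ℝ) + 1) ^ r)⁻¹ := by
  classical
  let I : Finset (Fin L) := Finset.univ.filter fun i => ∃ j, x (.inr (i, j)) ≠ y (.inr (i, j))
  have hI : ∀ i, ∃ j, i ∈ I → x (.inr (i, j)) ≠ y (.inr (i, j)) := by
    intro i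
    by_cases h : i ∈ I
    · obtain ⟨j, hj⟩ := (Finset.mem_filter.1 h).2
      exact ⟨j, fun _ => hj⟩
    · exact ⟨0, fun h' => (h h').elim⟩
  choose jf hjf using hI
  have key : ∀ d, proj col d x = proj col d y → r ≤ I.card ∧ ∀ i ∈ I, d i = jf i := by
    intro d h
    simp only [proj, Prod.mk.injEq] at h
    obtain ⟨h1, h2, h3⟩ := h
    constructor
    · refine (hcol _ _ h3 fun h4 => hxy (parts_injective d ?_)).trans (Finset.card_le_card ?_)
      · exact Prod.ext h1 (Prod.ext h2 h4)
      · intro i hi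
        exact Finset.mem_filter.2 ⟨Finset.mem_univ _, d i, (Finset.mem_filter.1 hi).2⟩
    · intro i hi
      by_contra hne
      rcases Fin.eq_self_or_eq_succAbove (d i) (jf i) with h4 | ⟨j, h4⟩
      · exact hne h4.symm
      · apply hjf i hi
        rw [h4]
        exact congrFun h2 (i, j)
  by_cases hr : r ≤ I.card
  · refine (frac_mono fun d h => (key d h).2).trans ?_
    rw [frac_agree, Fintype.card_fin]
    push_cast
    gcongr
    linarith [(Nat.cast_nonneg s : (0 : ℝ) ≤ s)]
  · have : frac (fun d => proj col d x = proj col d y) ≤ frac (fun _ : Fin L → Fin (s + 1) => False) :=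
      frac_mono fun d h => hr (key d h).1
    refine this.trans ?_
    simp only [frac, Finset.filter_false, Finset.card_empty, Nat.cast_zero, zero_div]
    positivity

variable [DecidableEq κ]

lemma sum_comp_eq_sum_card_mul [Fintype κ] (col : (Fin L → Bool) → κ) (f : κ → ℝ) :
    ∑ y, f (col y) = ∑ c, ((Finset.univ.filter fun y => col y = c).card : ℝ) * f c := by
  rw [← Finset.sum_fiberwise (s := Finset.univ) (g := col)]
  refine Finset.sum_congr rfl fun c _ => ?_
  rw [← nsmul_eq_mul, ← Finset.sum_const]
  exact Finset.sum_congr rfl fun y hy => by rw [(Finset.mem_filter.1 hy).2]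

/-- Adding the value at the colour `c₀` to the values at the other colours. -/
def xorAt {α β : Type*} (c₀ : κ) (H : α × β × κ → Bool) : α × β × κ → Bool :=
  fun z => if z.2.2 = c₀ then H z else (H z).xor (H (z.1, z.2.1, c₀))

lemma xorAt_involutive {α β : Type*} (c₀ : κ) :
    Function.Involutive (xorAt (α := α) (β := β) c₀) := by
  intro H
  funext ⟨u, z, c⟩
  by_cases hc : c = c₀ <;> simp [xorAt, hc]

/-- A random function of the visible part and the colour of the hidden part is close to a junta:
to its restriction to the colour `c₀`. -/
lemma frac_not_closeOn_le [Fintype κ] (col : (Fin L → Bool) → κ) (c₀ : κ) (d : Fin L → Fin (s + 1))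
    (W : Finset (Fin a → Bool)) (hW : W.Nonempty) {ε η : ℝ} (hη : 0 ≤ η)
    (hε : (W.card : ℝ) * (1 / 2 - ((Finset.univ.filter fun y => col y = c₀).card : ℝ) / (2 * 2 ^ L)
      + η) ≤ ε * 2 ^ a) :
    frac (fun H : (Fin a → Bool) × (Fin L × Fin s → Bool) × κ → Bool =>
      ¬ CloseOn (a + L * s) ε (fun x => decide ((fun i => x (.inl i)) ∈ W) && H (proj col d x)))
      ≤ Real.exp (-(2 * η ^ 2 * (W.card * 2 ^ (L * s)))) := by
  set N : κ → ℝ := fun c => ((Finset.univ.filter fun y => col y = c).card : ℝ)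
  have hN0 : ∀ c, 0 ≤ N c := fun c => by positivity
  have hNsum : ∑ c, N c = 2 ^ L := by
    have := sum_comp_eq_sum_card_mul col (fun _ => 1)
    simpa using this.symm
  have hNle : ∀ c, N c ≤ 2 ^ L := fun c => by
    rw [← hNsum]; exact Finset.single_le_sum (fun c _ => hN0 c) (Finset.mem_univ c)
  -- The number of hidden strings of a colour weights the corresponding bit of `H`. Colour `c₀` has
  -- weight zero, since the junta is exact there.
  let wt : (Fin a → Bool) × (Fin L × Fin s → Bool) × κ → ℝ :=
    fun i => if i.1 ∈ W ∧ i.2.2 ≠ c₀ then N i.2.2 else 0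
  have hsumW : ∀ B : ℝ, ∑ u : Fin a → Bool, ∑ z : Fin L × Fin s → Bool, (if u ∈ W then B else 0)
      = W.card * 2 ^ (L * s) * B := by
    intro B
    simp only [Finset.sum_const, Finset.card_univ, nsmul_eq_mul, Finset.sum_ite_mem,
      Finset.univ_inter, ← Finset.mul_sum]
    simp
    ring
  have hwt : ∑ i, wt i = W.card * 2 ^ (L * s) * (2 ^ L - N c₀) := by
    rw [Fintype.sum_prod_type]
    simp only [Fintype.sum_prod_type]
    rw [← hsumW]
    refine Finset.sum_congr rfl fun u _ => Finset.sum_congr rfl fun z _ => ?_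
    by_cases hu : u ∈ W
    · simp only [wt, hu, true_and, if_true, ← hNsum]
      rw [← Finset.sum_erase_eq_sub (Finset.mem_univ c₀), ← Finset.sum_filter]
      congr 1
      ext c; simp
    · simp [wt, hu]
  have hwt2 : ∑ i, wt i ^ 2 ≤ W.card * 2 ^ (L * s) * (2 ^ L) ^ 2 := by
    rw [Fintype.sum_prod_type]
    simp only [Fintype.sum_prod_type]
    rw [← hsumW]
    refine Finset.sum_le_sum fun u _ => Finset.sum_le_sum fun z _ => ?_
    by_cases hu : u ∈ W
    · simp only [wt, hu, true_and, if_true]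
      calc ∑ c, (if c ≠ c₀ then N c else 0) ^ 2 ≤ ∑ c, 2 ^ L * N c := by
            refine Finset.sum_le_sum fun c _ => ?_
            have := hN0 c
            have := hNle c
            split_ifs
            · nlinarith
            · nlinarith [pow_pos (two_pos : (0 : ℝ) < 2) L]
        _ = _ := by rw [← Finset.mul_sum, hNsum, sq]
    · simp [wt, hu]
  have hWc : (0 : ℝ) < W.card := by exact_mod_cast hW.card_pos
  have hchern := frac_sum_sgn_ge_le wt (τ := 2 * η * (W.card * 2 ^ (L * s) * 2 ^ L))
    (by positivity) (by positivity) hwt2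
  -- After this measure-preserving substitution, disagreement with the value at `c₀` is a single
  -- independent bit of `H`, so the distance is a weighted sum of independent bits.
  rw [← frac_comp_equiv (xorAt_involutive c₀).toPerm]
  refine le_trans (frac_mono ?_) (hchern.trans (le_of_eq ?_))
  · intro H hclose
    by_contra hlt
    push Not at hlt
    apply hclose
    refine ⟨fun x => decide ((fun i => x (.inl i)) ∈ W) &&
      H ((parts d x).1, (parts d x).2.1, c₀), ⟨Finset.univ.image Sum.inl ∪
        Finset.univ.image (fun p : Fin L × Fin s => Sum.inr (p.1, (d p.1).succAbove p.2)),
        ?_, ?_⟩, ?_⟩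
    · refine (Finset.card_union_le _ _).trans ?_
      have h1 := Finset.card_image_le (s := (Finset.univ : Finset (Fin a)))
        (f := (Sum.inl : Fin a → Fin a ⊕ Fin L × Fin (s + 1)))
      have h2 := Finset.card_image_le (s := (Finset.univ : Finset (Fin L × Fin s)))
        (f := fun p => (Sum.inr (p.1, (d p.1).succAbove p.2) : Fin a ⊕ Fin L × Fin (s + 1)))
      simp only [Finset.card_univ, Fintype.card_fin, Fintype.card_prod] at h1 h2
      omega
    · intro x y hxy
      have h1 : (fun i => x (.inl i)) = fun i => y (.inl i) :=
        funext fun i => hxy _ (by simp)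
      have h2 : (parts d x).2.1 = (parts d y).2.1 :=
        funext fun p => hxy _ (by
          simp only [Finset.coe_union, Finset.coe_image, Finset.coe_univ, Set.image_univ]
          exact Or.inr ⟨p, rfl⟩)
      have h3 : (parts d x).1 = (parts d y).1 := h1
      simp only [h1, h2, h3]
    · have hd : (hammingDist (fun x : Fin a ⊕ Fin L × Fin (s + 1) → Bool =>
            decide ((fun i => x (.inl i)) ∈ W) && (xorAt c₀ H) (proj col d x))
          (fun x => decide ((fun i => x (.inl i)) ∈ W) &&
            H ((parts d x).1, (parts d x).2.1, c₀)) : ℝ)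
          = ∑ i, wt i * (if H i = true then 1 else 0) := by
        rw [hammingDist, Finset.card_filter]
        push_cast
        rw [Fintype.sum_prod_type]
        simp only [Fintype.sum_prod_type]
        have : ∀ u z, ∑ c, wt (u, z, c) * (if H (u, z, c) = true then 1 else 0)
            = ∑ y, (if u ∈ W ∧ col y ≠ c₀ ∧ H (u, z, col y) = true then (1 : ℝ) else 0) := by
          intro u z
          rw [sum_comp_eq_sum_card_mul col
            (fun c => if u ∈ W ∧ c ≠ c₀ ∧ H (u, z, c) = true then (1 : ℝ) else 0)]
          refine Finset.sum_congr rfl fun c _ => ?_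
          simp only [wt]
          by_cases h1 : u ∈ W <;> by_cases h2 : c = c₀ <;> by_cases h3 : H (u, z, c) = true <;>
            simp [h1, h2, h3, N]
        simp only [this]
        rw [← (partsEquiv d).symm.sum_comp, Fintype.sum_prod_type]
        simp only [Fintype.sum_prod_type]
        refine Finset.sum_congr rfl fun u _ => Finset.sum_congr rfl fun z _ =>
          Finset.sum_congr rfl fun y _ => ?_
        have hp : parts d ((partsEquiv d).symm (u, z, y)) = (u, z, y) :=
          (partsEquiv d).apply_symm_apply (u, z, y)
        have hu : (fun i => (partsEquiv d).symm (u, z, y) (.inl i)) = u :=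
          congrArg Prod.fst hp
        simp only [proj, hp, hu, xorAt]
        by_cases h2 : col y = c₀
        · simp [h2]
        · by_cases h1 : u ∈ W <;> cases H (u, z, col y) <;> cases H (u, z, c₀) <;> simp [h1, h2]
      have hhalf : ∑ i, wt i * (if H i = true then 1 else 0)
          = (∑ i, wt i + ∑ i, wt i * sgn (H i)) / 2 := by
        rw [← Finset.sum_add_distrib, Finset.sum_div]
        refine Finset.sum_congr rfl fun i _ => ?_
        simp only [sgn]
        split_ifs <;> ring
      refine hd.le.trans ?_
      rw [hhalf, hwt]
      have hcard : (2 : ℝ) ^ Fintype.card (Fin a ⊕ Fin L × Fin (s + 1))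
          = 2 ^ a * (2 ^ (L * s) * 2 ^ L) := by
        simp only [Fintype.card_sum, Fintype.card_fin, Fintype.card_prod]
        rw [pow_add, mul_add, pow_add, mul_one]
      rw [hcard, ← mul_assoc]
      have hX : (0 : ℝ) < 2 ^ (L * s) * 2 ^ L := by positivity
      refine le_trans ?_ (mul_le_mul_of_nonneg_right hε hX.le)
      have : (W.card : ℝ) * (1 / 2 - N c₀ / (2 * 2 ^ L) + η) * (2 ^ (L * s) * 2 ^ L)
          = (W.card * 2 ^ (L * s) * (2 ^ L - N c₀)
            + 2 * η * (W.card * 2 ^ (L * s) * 2 ^ L)) / 2 := by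
        field_simp
      rw [this]
      linarith
  · congr 2
    field_simp

end hidden

/-! ### From randomized testers to decision trees. -/

lemma frac_eq_sum_ite {α : Type*} [Fintype α] (p : α → Prop) [DecidablePred p] :
    frac p = (∑ x, if p x then (1 : ℝ) else 0) / Fintype.card α := by
  unfold frac
  rw [Finset.card_filter]
  push_cast
  congr! 2

section probability

variable {n : ℕ}

lemma PMF.summable_toReal {α : Type*} (T : PMF α) : Summable fun t => (T t).toReal :=
  ENNReal.summable_toReal (by rw [T.tsum_coe]; exact ENNReal.one_ne_top)

lemma PMF.summable_toReal_mul {α : Type*} (T : PMF α) {g : α → ℝ} (h0 : ∀ t, 0 ≤ g t)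
    (h1 : ∀ t, g t ≤ 1) : Summable fun t => (T t).toReal * g t :=
  (PMF.summable_toReal T).of_nonneg_of_le (fun t => mul_nonneg ENNReal.toReal_nonneg (h0 t))
    fun t => mul_le_of_le_one_right ENNReal.toReal_nonneg (h1 t)

lemma PMF.tsum_toReal {α : Type*} (T : PMF α) : ∑' t, (T t).toReal = 1 := by
  rw [← ENNReal.tsum_toReal_eq (fun t => T.apply_ne_top t), T.tsum_coe, ENNReal.toReal_one]

lemma RandomizedAlg.toReal_prob (T : RandomizedAlg n) (f : BoolFun n) (b : Bool) :
    (RandomizedAlg.prob T f b).toReal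
      = ∑' t, (T t).toReal * if DecisionTree.eval f t = b then 1 else 0 := by
  classical
  unfold RandomizedAlg.prob
  rw [PMF.map_apply, ENNReal.tsum_toReal_eq]
  · refine tsum_congr fun t => ?_
    by_cases h : DecisionTree.eval f t = b
    · simp [h]
    · simp [h, Ne.symm h]
  · intro t
    split_ifs
    · exact T.apply_ne_top t
    · exact ENNReal.zero_ne_top

/-- Exchanges the random function with the random tree, as in Yao's principle, so that the coupling
can be applied to one tree at a time. -/
lemma sum_toReal_prob {Ω : Type*} [Fintype Ω] (T : RandomizedAlg n) (G : Ω → BoolFun n)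
    (b : Bool) :
    (∑ ω, (RandomizedAlg.prob T (G ω) b).toReal) / Fintype.card Ω
      = ∑' t, (T t).toReal * frac (fun ω => DecisionTree.eval (G ω) t = b) := by
  simp only [RandomizedAlg.toReal_prob]
  rw [← Summable.tsum_finsetSum, ← tsum_div_const]
  · refine tsum_congr fun t => ?_
    rw [← Finset.mul_sum, mul_div_assoc, frac_eq_sum_ite]
  · intro ω _
    exact PMF.summable_toReal_mul T (fun t => by split_ifs <;> norm_num)
      fun t => by split_ifs <;> norm_num

lemma two_thirds_mul_frac_le {Ω : Type*} [Fintype Ω] [Nonempty Ω] (T : RandomizedAlg n)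
    (G : Ω → BoolFun n) (b : Bool) (P : Ω → Prop)
    (h : ∀ ω, P ω → 2 / 3 ≤ RandomizedAlg.prob T (G ω) b) :
    frac P * (2 / 3) ≤ ∑' t, (T t).toReal * frac (fun ω => DecisionTree.eval (G ω) t = b) := by
  rw [← sum_toReal_prob]
  refine frac_mul_le_sum _ _ (fun _ => ENNReal.toReal_nonneg) fun ω hω => ?_
  have h1 := ENNReal.toReal_mono (PMF.apply_ne_top _ _) (h ω hω)
  have h2 : ((2 : ENNReal) / 3).toReal = 2 / 3 := by simp
  rwa [h2] at h1

lemma tsum_frac_true_add_false {Ω : Type*} [Fintype Ω] [Nonempty Ω] (T : RandomizedAlg n)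
    (G : Ω → BoolFun n) :
    ∑' t, (T t).toReal * frac (fun ω => DecisionTree.eval (G ω) t = true)
      + ∑' t, (T t).toReal * frac (fun ω => DecisionTree.eval (G ω) t = false) = 1 := by
  rw [← Summable.tsum_add]
  · rw [← PMF.tsum_toReal T]
    refine tsum_congr fun t => ?_
    have h := frac_not (fun ω => DecisionTree.eval (G ω) t = true)
    simp only [Bool.not_eq_true] at h
    rw [h]
    ring
  all_goals exact PMF.summable_toReal_mul T (fun t => frac_nonneg _) fun t => frac_le_one _

/-- If a tester accepts most of a first family and rejects most of a second one, then some of its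
decision trees distinguishes the two families. -/
lemma one_fifth_le_of_frac_eval_le {Ω Ω' : Type*} [Fintype Ω] [Nonempty Ω] [Fintype Ω']
    [Nonempty Ω'] (T : RandomizedAlg n) (G : Ω → BoolFun n) (G' : Ω' → BoolFun n)
    (P : Ω → Prop) (P' : Ω' → Prop) (hP : frac (fun ω => ¬ P ω) ≤ 1 / 10) (hP' : frac P' ≤ 1 / 10)
    (hacc : ∀ ω, P ω → 2 / 3 ≤ RandomizedAlg.prob T (G ω) true)
    (hrej : ∀ ω, ¬ P' ω → 2 / 3 ≤ RandomizedAlg.prob T (G' ω) false) {δ : ℝ}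
    (hδ : ∀ t ∈ T.support, frac (fun ω => DecisionTree.eval (G' ω) t = false)
      ≤ frac (fun ω => DecisionTree.eval (G ω) t = false) + δ) : 1 / 5 ≤ δ := by
  have hNO := two_thirds_mul_frac_le T G' false _ hrej
  have hYES := two_thirds_mul_frac_le T G true _ hacc
  have hsum := tsum_frac_true_add_false T G
  rw [frac_not] at hNO hP
  have hcouple : ∑' t, (T t).toReal * frac (fun ω => DecisionTree.eval (G' ω) t = false)
      ≤ ∑' t, (T t).toReal * frac (fun ω => DecisionTree.eval (G ω) t = false) + δ := by
    have h2 : δ = ∑' t, (T t).toReal * δ := by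
      rw [tsum_mul_right, PMF.tsum_toReal, one_mul]
    have hs := PMF.summable_toReal_mul T
      (fun t => frac_nonneg (fun ω => DecisionTree.eval (G ω) t = false)) (fun t => frac_le_one _)
    have hs' := (PMF.summable_toReal T).mul_right δ
    rw [h2, ← hs.tsum_add hs']
    refine Summable.tsum_le_tsum (fun t => ?_)
      (PMF.summable_toReal_mul T (fun t => frac_nonneg _) (fun t => frac_le_one _)) (hs.add hs')
    rw [← mul_add]
    by_cases ht : t ∈ T.support
    · exact mul_le_mul_of_nonneg_left (hδ t ht) ENNReal.toReal_nonneg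
    · simp [(T.apply_eq_zero_iff t).2 ht]
  linarith

end probability

/-! ### The query bound for general parameters. -/

lemma card_filter_inl_mem {A B : Type*} [Fintype A] [DecidableEq A] [Fintype B] [DecidableEq B]
    (W : Finset (A → Bool)) :
    (Finset.univ.filter fun x : A ⊕ B → Bool => decide ((fun i => x (.inl i)) ∈ W) = true).card
      = W.card * 2 ^ Fintype.card B := by
  have h1 : (W ×ˢ (Finset.univ : Finset (B → Bool))).card = W.card * 2 ^ Fintype.card B := by
    rw [Finset.card_product]; simp
  rw [← h1]
  refine Finset.card_bij (fun x _ => Equiv.sumArrowEquivProdArrow _ _ _ x) ?_ ?_ ?_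
  · intro x hx
    simpa [Equiv.sumArrowEquivProdArrow, Function.comp_def] using hx
  · intro x _ y _ h
    exact (Equiv.injective _) h
  · intro z hz
    refine ⟨(Equiv.sumArrowEquivProdArrow _ _ _).symm z, ?_, Equiv.apply_symm_apply _ _⟩
    simpa [Equiv.sumArrowEquivProdArrow] using hz

/-- The lower bound on the number of queries, for a given choice of the parameters of the
construction. -/
theorem pow_le_of_tester {a L s r k' q n : ℕ} {κ : Type*} [Fintype κ] [DecidableEq κ]
    (col : (Fin L → Bool) → κ)
    (hcol : ∀ y y', col y = col y' → y ≠ y' → r ≤ hammingDist y y') (c₀ : κ)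
    (W : Finset (Fin a → Bool)) (hW : W.Nonempty) {ε₁ ε₂ η β : ℝ} (hη : 0 ≤ η) (hβ : 0 ≤ β)
    (hyes : (W.card : ℝ) * (1 / 2 - ((Finset.univ.filter fun y => col y = c₀).card : ℝ) /
      (2 * 2 ^ L) + η) ≤ ε₁ * 2 ^ a)
    (hno : ε₂ * 2 ^ a ≤ W.card * (1 / 2 - β))
    (hyes_prob : Real.exp (-(2 * η ^ 2 * (W.card * 2 ^ (L * s)))) ≤ 1 / 10)
    (hno_prob : 2 ^ (a + L * (s + 1)) * 2 ^ (2 ^ k') *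
      Real.exp (-(2 * β ^ 2 * (W.card * 2 ^ (L * (s + 1))))) ≤ 1 / 10)
    (hn : a + L * (s + 1) ≤ n) (T : RandomizedAlg n)
    (hT : IsTolerantJuntaTester (a + L * s) k' ε₁ ε₂ T)
    (hq : ∀ t ∈ T.support, ∀ f, DecisionTree.numQueries f t ≤ q) :
    ((s : ℝ) + 1) ^ r ≤ 10 * (q : ℝ) ^ 2 := by
  -- The remaining `m` coordinates are irrelevant padding.
  obtain ⟨m, rfl⟩ := Nat.exists_eq_add_of_le hn
  have hVcard : Fintype.card (Fin a ⊕ Fin L × Fin (s + 1)) = a + L * (s + 1) := by simp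
  obtain ⟨e⟩ : Nonempty ((Fin a ⊕ Fin L × Fin (s + 1)) ⊕ Fin m ≃ Fin (a + L * (s + 1) + m)) :=
    ⟨Fintype.equivFinOfCardEq (by simp)⟩
  have hgate := card_filter_inl_mem (B := Fin L × Fin (s + 1)) W
  rw [Fintype.card_prod, Fintype.card_fin, Fintype.card_fin] at hgate
  generalize hg : (fun x : Fin a ⊕ Fin L × Fin (s + 1) → Bool =>
    decide ((fun i => x (.inl i)) ∈ W)) = gate at hgate
  have hg' : ∀ x, gate x = decide ((fun i => x (.inl i)) ∈ W) := fun x => by rw [← hg]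
  simp only [← hg'] at hgate
  have hfar : frac (fun F : (Fin a ⊕ Fin L × Fin (s + 1) → Bool) → Bool =>
      CloseOn k' ε₂ (fun x => gate x && F x)) ≤ 1 / 10 := by
    refine (frac_closeOn_le gate hβ (Nat.mul_pos hW.card_pos (by positivity)) hgate ?_).trans ?_
    · rw [hVcard, pow_add]
      push_cast
      have := mul_le_mul_of_nonneg_right hno
        (by positivity : (0 : ℝ) ≤ 2 ^ (L * (s + 1)))
      linarith
    · rw [hVcard]
      push_cast
      exact hno_prob
  have hclose : frac (fun z : (Fin L → Fin (s + 1)) ×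
      ((Fin a → Bool) × (Fin L × Fin s → Bool) × κ → Bool) =>
      ¬ CloseOn (a + L * s) ε₁ (fun x => gate x && z.2 (proj col z.1 x))) ≤ 1 / 10 := by
    refine frac_le_of_fiber_le _ fun d => ?_
    simp only [hg']
    exact (frac_not_closeOn_le col c₀ d W hW hη hyes).trans hyes_prob
  have hδ : ∀ t ∈ T.support, _ ≤ _ + (q : ℝ) ^ 2 * (((s : ℝ) + 1) ^ r)⁻¹ := fun t ht =>
    frac_eval_le_add_of_collision_le gate (fun p v => p (e (.inl v))) (proj col) false t (hq t ht)
      (by positivity) (fun x y hxy => frac_proj_eq_le hcol x y hxy)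
  have hacc := fun (z : (Fin L → Fin (s + 1)) ×
      ((Fin a → Bool) × (Fin L × Fin s → Bool) × κ → Bool))
    (hz : CloseOn (a + L * s) ε₁ (fun x => gate x && z.2 (proj col z.1 x))) =>
    hT.accepts _ (hz.closeToJunta e)
  have hrej := fun (F : (Fin a ⊕ Fin L × Fin (s + 1) → Bool) → Bool)
    (hF : ¬ CloseOn k' ε₂ (fun x => gate x && F x)) =>
    hT.rejects _ (farFromJuntas_of_not_closeOn e hF)
  have hfifth := one_fifth_le_of_frac_eval_le T _ _ _ _ hclose hfar hacc hrej hδ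
  rw [← div_eq_mul_inv, le_div_iff₀ (by positivity)] at hfifth
  linarith [sq_nonneg (q : ℝ)]

/-! ### Constants against parities: two queries are needed. -/

section parity

variable {n : ℕ}

/-- The parity function, shifted by `b`. -/
noncomputable def parityFun (b : Bool) : BoolFun n :=
  fun x => b.xor (decide (0 < ∏ i, sgn (x i)))

lemma parityFun_update_not (b : Bool) (x : Fin n → Bool) (i : Fin n) :
    parityFun b (Function.update x i (!x i)) = !parityFun b x := by
  have h1 : (fun j => sgn (Function.update x i (!x i) j))
      = Function.update (fun j => sgn (x j)) i (-sgn (x i)) := by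
    funext j
    by_cases hj : j = i
    · subst hj
      simp only [Function.update_self, sgn]
      cases x j <;> simp
    · simp [Function.update_of_ne hj]
  have h2 : ∏ j, sgn (Function.update x i (!x i) j) = -∏ j, sgn (x j) := by
    rw [Finset.prod_congr rfl fun j _ => congrFun h1 j,
      Finset.prod_update_of_mem (Finset.mem_univ i),
      Finset.prod_eq_mul_prod_sdiff_singleton_of_mem (Finset.mem_univ i)]
    ring
  have h3 : ∏ j, sgn (x j) ≠ 0 :=
    Finset.prod_ne_zero_iff.2 fun j _ => by unfold sgn; split_ifs <;> norm_num
  simp only [parityFun, h2]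
  rcases lt_or_gt_of_ne h3 with h | h
  · simp [h, h.le.not_gt]
  · simp [h, h.le.not_gt]

/-- Flipping a coordinate outside `S` changes the parity but not the junta, so it matches errors
with agreements and exactly half of the points are errors. -/
lemma farFromJuntas_parityFun {k : ℕ} {ε : ℝ} (hk : k < n) (hε : ε < 1 / 2) (b : Bool) :
    FarFromJuntas k ε (parityFun (n := n) b) := by
  rintro g ⟨S, hS, hg⟩ hd
  obtain ⟨i, hi⟩ : ∃ i, i ∉ S := by
    by_contra! h
    have := Finset.card_le_card (fun j _ => h j : (Finset.univ : Finset (Fin n)) ⊆ S)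
    simp only [Finset.card_univ, Fintype.card_fin] at this
    omega
  have hflip : ∀ x : Fin n → Bool, g (Function.update x i (!x i)) = g x := by
    intro x
    refine hg fun j hj => Function.update_of_ne ?_ _ _
    rintro rfl
    exact hi hj
  have hbij : (Finset.univ.filter fun x : Fin n → Bool => parityFun b x ≠ g x).card
      = (Finset.univ.filter fun x : Fin n → Bool => ¬ parityFun b x ≠ g x).card := by
    refine Finset.card_bij' (fun x _ => Function.update x i (!x i))
      (fun x _ => Function.update x i (!x i)) ?_ ?_ ?_ ?_
    · intro x hx
      simp only [Finset.mem_filter, Finset.mem_univ, true_and, parityFun_update_not, hflip] at hx ⊢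
      revert hx
      cases parityFun b x <;> cases g x <;> simp
    · intro x hx
      simp only [Finset.mem_filter, Finset.mem_univ, true_and, parityFun_update_not, hflip] at hx ⊢
      revert hx
      cases parityFun b x <;> cases g x <;> simp
    · intro x _; simp
    · intro x _; simp
  have htot := Finset.card_filter_add_card_filter_not (s := (Finset.univ : Finset (Fin n → Bool)))
    (fun x => parityFun b x ≠ g x)
  rw [← hbij, Finset.card_univ, Fintype.card_fun, Fintype.card_bool, Fintype.card_fin] at htot
  have htot' : (hammingDist (parityFun b) g : ℝ) + hammingDist (parityFun b) g = 2 ^ n := by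
    exact_mod_cast htot
  unfold IsClose at hd
  have : (0 : ℝ) < 2 ^ n := by positivity
  nlinarith

/-- One query is never enough. -/
lemma exists_two_le_numQueries {k k' : ℕ} {ε₁ ε₂ : ℝ} (hk : k' < n) (hε₁ : 0 ≤ ε₁)
    (hε₂ : ε₂ < 1 / 2) (T : RandomizedAlg n) (hT : IsTolerantJuntaTester k k' ε₁ ε₂ T) :
    ∃ t ∈ T.support, ∃ f : BoolFun n, 2 ≤ DecisionTree.numQueries f t := by
  by_contra! hlt
  have hA := two_thirds_mul_frac_le T (fun b : Bool => (fun _ => b : BoolFun n)) true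
    (fun _ => True) (fun b _ => hT.accepts _ ⟨fun _ => b, ⟨∅, by simp, by
      simpa using dependsOn_const b⟩, by
      unfold IsClose; rw [hammingDist_self]; push_cast; positivity⟩)
  have hR := two_thirds_mul_frac_le T (fun b : Bool => (parityFun b : BoolFun n)) false
    (fun _ => True) (fun b _ => hT.rejects _ (farFromJuntas_parityFun hk hε₂ b))
  have hsum := tsum_frac_true_add_false T (fun b : Bool => (fun _ => b : BoolFun n))
  -- With a uniform shift `b`, the answer to any single query is an unbiased bit in both families.
  have heq : ∑' t, (T t).toReal *
        frac (fun b : Bool => DecisionTree.eval (parityFun b : BoolFun n) t = false)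
      = ∑' t, (T t).toReal *
        frac (fun b : Bool => DecisionTree.eval (fun _ => b : BoolFun n) t = false) := by
    refine tsum_congr fun t => ?_
    by_cases ht : t ∈ T.support
    · congr 1
      cases t with
      | answer c => rfl
      | query x next =>
        have hnext : ∀ b, ∃ c, next b = .answer c := by
          intro b
          have h := hlt _ ht (fun _ => b)
          rcases hb : next b with c | ⟨y, nx⟩
          · exact ⟨c, rfl⟩
          · simp only [DecisionTree.numQueries, hb] at h
            omega
        choose ans hans using hnext
        simp only [DecisionTree.eval, hans, parityFun]
        cases decide (0 < ∏ i, sgn (x i))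
        · simp
        · simp only [Bool.xor_true]
          exact frac_comp_equiv Equiv.boolNot (fun b => ans b = false)
    · simp [(T.apply_eq_zero_iff t).2 ht]
  have h1 : frac (fun _ : Bool => True) = 1 := by simp [frac]
  rw [h1] at hA hR
  linarith

end parity

/-! ### Numerical estimates and choice of parameters. -/

lemma exp_neg_le_one_tenth {x : ℝ} (hx : 3 ≤ x) : Real.exp (-x) ≤ 1 / 10 := by
  have h1 : Real.exp 3 = Real.exp 1 ^ 3 := by rw [← Real.exp_nat_mul]; norm_num
  have h2 : (10 : ℝ) ≤ Real.exp x := by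
    calc (10 : ℝ) ≤ (2.7 : ℝ) ^ 3 := by norm_num
      _ ≤ Real.exp 1 ^ 3 := by
        gcongr
        linarith [Real.exp_one_gt_d9]
      _ = Real.exp 3 := h1.symm
      _ ≤ _ := Real.exp_le_exp.2 hx
  rw [Real.exp_neg, inv_eq_one_div]
  exact one_div_le_one_div_of_le (by norm_num) h2

/-- Since `log 2 < 0.7`, the two powers cost at most `1.4 * 2 ^ k` in the exponent, which leaves at
least `0.6 * 2 ^ k > 3`. -/
lemma two_pow_mul_two_pow_mul_exp_le {m k : ℕ} {E : ℝ} (hm : m ≤ 2 ^ k) (hk : 3 ≤ k)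
    (hE : 2 * 2 ^ k ≤ E) : (2 : ℝ) ^ m * 2 ^ (2 ^ k) * Real.exp (-E) ≤ 1 / 10 := by
  have h2 : ∀ j : ℕ, (2 : ℝ) ^ j ≤ Real.exp (0.7 * j) := by
    intro j
    rw [mul_comm, Real.exp_nat_mul]
    gcongr
    calc (2 : ℝ) = Real.exp (Real.log 2) := (Real.exp_log two_pos).symm
      _ ≤ _ := Real.exp_le_exp.2 (by linarith [Real.log_two_lt_d9])
  have hm' : (m : ℝ) ≤ 2 ^ k := by exact_mod_cast hm
  have hk' : (2 : ℝ) ^ 3 ≤ 2 ^ k := pow_le_pow_right₀ (by norm_num) hk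
  have hZ : (2 : ℝ) ^ (2 ^ k) ≤ Real.exp (0.7 * 2 ^ k) := by
    have := h2 (2 ^ k)
    push_cast at this
    exact this
  calc (2 : ℝ) ^ m * 2 ^ (2 ^ k) * Real.exp (-E)
      ≤ Real.exp (0.7 * m) * Real.exp (0.7 * 2 ^ k) * Real.exp (-E) := by
        gcongr
        exact h2 m
    _ = Real.exp (-(E - 0.7 * m - 0.7 * 2 ^ k)) := by
        rw [← Real.exp_add, ← Real.exp_add]; congr 1; ring
    _ ≤ 1 / 10 := exp_neg_le_one_tenth (by linarith)

lemma two_mul_le_two_pow {k : ℕ} (hk : 1 ≤ k) : 2 * k ≤ 2 ^ k := by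
  obtain ⟨j, rfl⟩ := Nat.exists_eq_add_of_le' hk
  have : j < 2 ^ j := Nat.lt_two_pow_self
  rw [pow_succ]
  omega

lemma exists_large_color {L M : ℕ} (hM : 0 < M) (col : (Fin L → Bool) → Fin M) :
    ∃ c₀, 1 / (2 * (M : ℝ)) ≤
      ((Finset.univ.filter fun y => col y = c₀).card : ℝ) / (2 * 2 ^ L) := by
  have : Nonempty (Fin M) := ⟨⟨0, hM⟩⟩
  have hMR : (0 : ℝ) < M := by exact_mod_cast hM
  obtain ⟨c₀, -, h⟩ := Finset.exists_le_of_sum_le (s := (Finset.univ : Finset (Fin M)))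
    (f := fun _ => (2 : ℝ) ^ L / M)
    (g := fun c => ((Finset.univ.filter fun y => col y = c).card : ℝ)) Finset.univ_nonempty (by
      have := sum_comp_eq_sum_card_mul col (fun _ => 1)
      simp only [mul_one] at this
      rw [← this]
      simp
      field_simp
      rfl)
  refine ⟨c₀, ?_⟩
  rw [div_le_div_iff₀ (by positivity) (by positivity)]
  rw [div_le_iff₀ hMR] at h
  linarith

/-- Here `A` is the number of points of the free block, `i` the inverse number of colours and `w`
the size of the region. Passing from `i / 8` to `3 * i / 8` saves `w * i / 4`, at least `0.005 * A *
i`. Half of this pays for `(ε₂ - ε₁) * A`, and the other half, at least `1 / 2`, for the rounding of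
`w`. -/
lemma density_mul_le {A B D i w ε₁ ε₂ : ℝ} (hε₁ : 0.01 ≤ ε₁) (hlt : ε₁ < ε₂) (hD : 0 < D)
    (hiD : i * D = 1) (hDB : 200 * D ≤ B) (hB2 : 2 ≤ B) (hBA : B ≤ A)
    (hgap : (ε₂ - ε₁) * (B * B) ≤ 1) (hw₁ : ε₂ * A ≤ w * (1 / 2 - i / 8))
    (hw₂ : (w - 1) * (1 / 2 - i / 8) ≤ ε₂ * A) : w * (1 / 2 - 3 * i / 8) ≤ ε₁ * A := by
  have hi : 0 < i := pos_of_mul_pos_left (by rw [hiD]; exact one_pos) hD.le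
  have hδ : 0 ≤ (ε₂ - ε₁) * B := mul_nonneg (by linarith) (by linarith)
  have hA : 0 < A := by linarith
  have hwpos : 0 < w := by
    by_contra! h
    nlinarith
  have h4 : (ε₂ - ε₁) * B ≤ i / 200 := by
    have h3 := mul_le_mul_of_nonneg_right
      ((mul_le_mul_of_nonneg_left hDB hδ).trans (by linarith : (ε₂ - ε₁) * B * B ≤ 1)) hi.le
    linear_combination h3 / 200 - (ε₂ - ε₁) * B * hiD
  have h5 : ε₂ - ε₁ ≤ i / 400 := by nlinarith
  have h6 : 200 ≤ A * i := by
    have := mul_le_mul_of_nonneg_right (hDB.trans hBA) hi.le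
    linarith
  have h7 := mul_le_mul_of_nonneg_right h5 hA.le
  have h8 : 0.01 * (A * i) ≤ ε₂ * (A * i) :=
    mul_le_mul_of_nonneg_right (by linarith) (by positivity)
  have h9 : 2 * (ε₂ * A) ≤ w := by
    linarith [mul_pos hwpos hi]
  have h10 := mul_le_mul_of_nonneg_right h9 hi.le
  linarith

lemma numQueries_lower_bound_of_small_gap {k ℓ r n q : ℕ} {ε₁ ε₂ : ℝ} (hε₁ : 0.01 ≤ ε₁)
    (hlt : ε₁ < ε₂) (hε₂ : ε₂ ≤ 0.49) (hr : 1 ≤ r) (hk : 100 * r ≤ k)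
    (hgap : (ε₂ - ε₁) * 2 ^ (100 * r) ≤ 1) (hℓ : ℓ ≤ 5 * r + 5) (hn : k + 44 * r ≤ n)
    (T : RandomizedAlg n) (hT : IsTolerantJuntaTester k (k + ℓ) ε₁ ε₂ T)
    (hq : ∀ t ∈ T.support, ∀ f, DecisionTree.numQueries f t ≤ q) :
    (((k / (88 * r) : ℕ) : ℝ) + 1) ^ r ≤ 10 * (q : ℝ) ^ 2 := by
  obtain ⟨col, hcol⟩ := exists_coloring_of_code r
  obtain ⟨c₀, hc₀⟩ := exists_large_color (by positivity) col
  -- Since `88 = 2 * 44`, the visible coordinates of the blocks use at most half of `k`, which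
  -- leaves `a ≥ 50 * r`.
  set s := k / (88 * r) with hs
  have hs2 : 88 * r * s ≤ k := Nat.mul_div_le k (88 * r)
  obtain ⟨a, ha⟩ : ∃ a, k = a + 44 * r * s :=
    ⟨k - 44 * r * s, by have : 44 * r * s ≤ 88 * r * s := by gcongr; norm_num
                        omega⟩
  have ha2 : 50 * r ≤ a := by
    have : 88 * r * s = 2 * (44 * r * s) := by ring
    omega
  set D : ℝ := 2 ^ (8 * r) with hD
  have hDcast : ((2 ^ (8 * r) : ℕ) : ℝ) = D := by push_cast; rfl
  rw [hDcast] at hc₀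
  set A : ℝ := 2 ^ a with hA
  have hD256 : 256 ≤ D := by
    calc (256 : ℝ) = 2 ^ 8 := by norm_num
      _ ≤ D := pow_le_pow_right₀ (by norm_num) (by omega)
  have hApos : 0 < A := by positivity
  have hDpos : 0 < D := by positivity
  have hAD : 200 * D ≤ 2 ^ (50 * r) := by
    calc 200 * D ≤ 2 ^ 8 * D := by gcongr; norm_num
      _ = 2 ^ (8 + 8 * r) := by rw [pow_add]
      _ ≤ _ := pow_le_pow_right₀ (by norm_num) (by omega)
  have hBA : (2 : ℝ) ^ (50 * r) ≤ A := pow_le_pow_right₀ (by norm_num) ha2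
  have hBsq : (2 : ℝ) ^ (100 * r) = 2 ^ (50 * r) * 2 ^ (50 * r) := by rw [← pow_add]; congr 1; ring
  set B : ℝ := 2 ^ (50 * r)
  have hBpos : 0 < B := by positivity
  have hDinv : 1 / D ≤ 1 / 256 := one_div_le_one_div_of_le (by norm_num) hD256
  set i : ℝ := 1 / D with hi
  have hiD : i * D = 1 := by rw [hi]; field_simp
  have hipos : 0 < i := by positivity
  have hfac : 0 < 1 / 2 - i / 8 := by linarith
  -- The least size for which the NO error, a fraction `1/2 - i/8` of the region, reaches `ε₂`.
  obtain ⟨w, hw1, hw2, hw3⟩ : ∃ w : ℕ, ε₂ * A ≤ w * (1 / 2 - i / 8) ∧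
      ((w : ℝ) - 1) * (1 / 2 - i / 8) ≤ ε₂ * A ∧ w ≤ 2 ^ a := by
    refine ⟨⌈ε₂ * A / (1 / 2 - i / 8)⌉₊, ?_, ?_, ?_⟩
    · rw [← div_le_iff₀ hfac]; exact Nat.le_ceil _
    · rw [← le_div_iff₀ hfac]
      have := Nat.ceil_lt_add_one (a := ε₂ * A / (1 / 2 - i / 8))
        (by apply div_nonneg _ hfac.le; nlinarith)
      linarith
    · rw [Nat.ceil_le, div_le_iff₀ hfac]
      push_cast
      rw [← hA]
      nlinarith
  have hwA : 0.02 * A ≤ w := by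
    have : (w : ℝ) * (1 / 2 - i / 8) ≤ w * (1 / 2) := by gcongr; linarith
    nlinarith
  obtain ⟨W, -, hWcard⟩ := Finset.exists_subset_card_eq
    (s := (Finset.univ : Finset (Fin a → Bool))) (n := w) (by simpa using hw3)
  have hWne : W.Nonempty := by
    rw [← Finset.card_pos, hWcard]
    have : (0 : ℝ) < w := by linarith [show (0:ℝ) < 0.02 * A by positivity]
    exact_mod_cast this
  have hkA : (2 : ℝ) ^ k = A * 2 ^ (44 * r * s) := by rw [hA, ← pow_add, ← ha]
  have hkD : 4800 * D ^ 2 ≤ (2 : ℝ) ^ k := by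
    calc 4800 * D ^ 2 ≤ 2 ^ 13 * D ^ 2 := by gcongr; norm_num
      _ = 2 ^ (13 + 8 * r * 2) := by rw [hD, ← pow_mul, ← pow_add]
      _ ≤ _ := pow_le_pow_right₀ (by norm_num) (by omega)
  -- The `44 * r` hidden bits outweigh both the slack `D ^ 2` and the `ℓ` extra junta coordinates in
  -- the union bound.
  have hLD : 3200 * D ^ 2 * 2 ^ ℓ ≤ (2 : ℝ) ^ (44 * r) := by
    calc 3200 * D ^ 2 * 2 ^ ℓ ≤ 2 ^ 12 * D ^ 2 * 2 ^ ℓ := by gcongr; norm_num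
      _ = 2 ^ (12 + 8 * r * 2 + ℓ) := by rw [hD, ← pow_mul, ← pow_add, ← pow_add]
      _ ≤ _ := pow_le_pow_right₀ (by norm_num) (by omega)
  have hi2 : i ^ 2 * D ^ 2 = 1 := by rw [← mul_pow, hiD, one_pow]
  refine pow_le_of_tester (L := 44 * r) (k' := k + ℓ) (a := a) (ε₁ := ε₁) (ε₂ := ε₂) col hcol c₀ W
    hWne (η := i / 8) (β := i / 8) (by positivity) (by positivity) ?_ ?_ ?_ ?_ (n := n) ?_ T ?_ hq
  · rw [hWcard]
    have h1 : 1 / (2 * D) = i / 2 := by rw [hi]; field_simp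
    rw [h1] at hc₀
    calc (w : ℝ) * (1 / 2 - ((Finset.univ.filter fun y => col y = c₀).card : ℝ) /
          (2 * 2 ^ (44 * r)) + i / 8)
        ≤ w * (1 / 2 - 3 * i / 8) := by gcongr; linarith
      _ ≤ ε₁ * A := density_mul_le hε₁ hlt hDpos hiD hAD (by linarith) hBA (by rwa [← hBsq]) hw1 hw2
  · rw [hWcard]; linarith
  · apply exp_neg_le_one_tenth
    rw [hWcard]
    calc (3 : ℝ) = i ^ 2 / 1600 * (4800 * D ^ 2) := by linear_combination (-3) * hi2
      _ ≤ i ^ 2 / 1600 * (A * 2 ^ (44 * r * s)) := by rw [← hkA]; gcongr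
      _ = 2 * (i / 8) ^ 2 * (0.02 * A * 2 ^ (44 * r * s)) := by ring
      _ ≤ _ := by gcongr
  · have hexp : a + 44 * r * (s + 1) = k + 44 * r := by rw [ha]; ring
    rw [hexp]
    apply two_pow_mul_two_pow_mul_exp_le
    · have h1 := two_mul_le_two_pow (k := k) (by omega)
      have h2 : 2 ^ k ≤ 2 ^ (k + ℓ) := Nat.pow_le_pow_right two_pos (by omega)
      omega
    · omega
    · rw [hWcard]
      calc (2 : ℝ) * 2 ^ (k + ℓ) = i ^ 2 / 1600 * (2 ^ k * (3200 * D ^ 2 * 2 ^ ℓ)) := by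
            rw [pow_add]; linear_combination (-2 * 2 ^ k * 2 ^ ℓ) * hi2
        _ ≤ i ^ 2 / 1600 * (A * 2 ^ (44 * r * s) * 2 ^ (44 * r)) := by rw [← hkA]; gcongr
        _ = 2 * (i / 8) ^ 2 * (0.02 * A * 2 ^ (44 * r * (s + 1))) := by
            rw [mul_add, pow_add, mul_one]; ring
        _ ≤ _ := by gcongr
  · rw [mul_add, ← add_assoc, ← ha, mul_one]; exact hn
  · rw [← ha]; exact hT

lemma numQueries_lower_bound_of_large_gap {k ℓ n q : ℕ} {ε₁ ε₂ : ℝ} (hε₁ : 0.01 ≤ ε₁)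
    (hε₂ : ε₂ ≤ 0.49) (hk : 60 ≤ k) (hℓ : ℓ ≤ 40) (hn : k + 60 ≤ n)
    (T : RandomizedAlg n) (hT : IsTolerantJuntaTester k (k + ℓ) ε₁ ε₂ T)
    (hq : ∀ t ∈ T.support, ∀ f, DecisionTree.numQueries f t ≤ q) :
    ((k / 60 : ℕ) : ℝ) + 1 ≤ 10 * (q : ℝ) ^ 2 := by
  set s := k / 60 with hs
  obtain ⟨a, ha⟩ : ∃ a, k = a + 60 * s := ⟨k - 60 * s, by omega⟩
  have hApos : (0 : ℝ) < 2 ^ a := by positivity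
  have hk2 : (2 : ℝ) ^ k = 2 ^ a * 2 ^ (60 * s) := by rw [← pow_add, ← ha]
  have hk60 : (2 : ℝ) ^ 60 ≤ 2 ^ k := pow_le_pow_right₀ (by norm_num) hk
  have hl40 : (2 : ℝ) ^ ℓ ≤ 2 ^ 40 := pow_le_pow_right₀ (by norm_num) hℓ
  have hcard : (((Finset.univ : Finset (Fin a → Bool)).card : ℕ) : ℝ) = 2 ^ a := by
    simp
  rw [← pow_one ((s : ℝ) + 1)]
  -- With one colour the YES functions ignore the hidden bits and are exact juntas. The region is
  -- the whole cube, and distinct hidden strings have distance at least `1`.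
  refine pow_le_of_tester (L := 60) (k' := k + ℓ) (a := a) (κ := Unit) (ε₁ := ε₁) (ε₂ := ε₂)
    (fun _ => ()) ?_ () Finset.univ
    Finset.univ_nonempty (η := 0.01) (β := 0.01) (by norm_num) (by norm_num) ?_ ?_ ?_ ?_ (n := n)
    ?_ T ?_ hq
  · intro y y' _ h
    exact hammingDist_pos.2 h
  · rw [hcard]
    have h1 : (((Finset.univ : Finset (Fin 60 → Bool)).filter fun _ => () = ()).card : ℝ)
        = 2 ^ 60 := by simp; norm_num
    rw [h1]
    have h2 : (2 : ℝ) ^ 60 / (2 * 2 ^ 60) = 1 / 2 := by field_simp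
    rw [h2]
    nlinarith
  · rw [hcard]; nlinarith
  · apply exp_neg_le_one_tenth
    rw [hcard, ← hk2]
    norm_num at hk60 ⊢
    linarith
  · have hexp : a + 60 * (s + 1) = k + 60 := by rw [ha]; ring
    rw [hexp]
    apply two_pow_mul_two_pow_mul_exp_le
    · have h1 := two_mul_le_two_pow (k := k) (by omega)
      have h2 : 2 ^ k ≤ 2 ^ (k + ℓ) := Nat.pow_le_pow_right two_pos (by omega)
      omega
    · omega
    · rw [hcard, ← pow_add, hexp, pow_add, pow_add]
      have h1 : (2 : ℝ) ^ k * 2 ^ ℓ ≤ 2 ^ k * 2 ^ 40 := mul_le_mul_of_nonneg_left hl40 (by positivity)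
      have h2 : (0 : ℝ) < 2 ^ k := by positivity
      calc (2 : ℝ) * (2 ^ k * 2 ^ ℓ) ≤ 2 * (2 ^ k * 2 ^ 40) := by linarith
        _ ≤ 2 * 0.01 ^ 2 * (2 ^ k * 2 ^ 60) := by
          norm_num
          linarith
  · omega
  · rw [← ha]; exact hT

end JuntaTesting

/-! ### Assembling the ranges of the gap. -/

theorem theorem3p1 (C : ℝ) (hC : 0 < C) :
    ∃ c : ℝ, 0 < c ∧
      ∀ (k : ℕ) (ε₁ ε₂ : ℝ), (0.01 : ℝ) ≤ ε₁ → ε₁ < ε₂ → ε₂ ≤ (0.49 : ℝ) →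
        (2 : ℝ) ^ (-(C * (k : ℝ))) ≤ ε₂ - ε₁ →
        ∃ n₀ : ℕ, ∀ n : ℕ, n₀ ≤ n → ∀ T : JuntaTesting.RandomizedAlg n,
          JuntaTesting.IsTolerantJuntaTester k
              (k + ⌊-Real.logb 2 (ε₂ - ε₁) / 20⌋₊) ε₁ ε₂ T →
            ∃ t ∈ T.support, ∃ f : JuntaTesting.BoolFun n,
              ((k : ℝ) / (-Real.logb 2 (ε₂ - ε₁))) ^ (-(c * Real.logb 2 (ε₂ - ε₁))) ≤
                (JuntaTesting.DecisionTree.numQueries f t : ℝ) := by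
  refine ⟨1 / 2000000, by norm_num, ?_⟩
  intro k ε₁ ε₂ hε₁ hlt hε₂ _
  set lam : ℝ := -Real.logb 2 (ε₂ - ε₁) with hlam
  have hgap : ε₂ - ε₁ = 2 ^ (-lam) := by
    rw [hlam, neg_neg, Real.rpow_logb (by norm_num) (by norm_num) (by linarith)]
  have hexpo : -(1 / 2000000 * Real.logb 2 (ε₂ - ε₁)) = lam / 2000000 := by rw [hlam]; ring
  rw [hexpo]
  have hlam1 : 1 < lam := by
    by_contra! h
    have h1 : (2 : ℝ) ^ (-1 : ℝ) ≤ 2 ^ (-lam) :=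
      Real.rpow_le_rpow_of_exponent_le (by norm_num) (by linarith)
    rw [← hgap, Real.rpow_neg_one] at h1
    linarith
  have hk0 : (0 : ℝ) ≤ k := Nat.cast_nonneg k
  set R : ℝ := ((k : ℝ) / lam) ^ (lam / 2000000) with hR
  have hR0 : 0 ≤ R := by positivity
  have of_bound : ∀ {n : ℕ} (T : JuntaTesting.RandomizedAlg n),
      (¬ ∃ t ∈ T.support, ∃ f : JuntaTesting.BoolFun n,
        R ≤ (JuntaTesting.DecisionTree.numQueries f t : ℝ)) →
      ∀ t ∈ T.support, ∀ f, JuntaTesting.DecisionTree.numQueries f t ≤ ⌊R⌋₊ := by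
    intro n T h t ht f
    push Not at h
    exact Nat.le_floor (h t ht f).le
  have hfloor : ((⌊R⌋₊ : ℕ) : ℝ) ^ 2 ≤ R ^ 2 := by
    gcongr
    exact Nat.floor_le hR0
  by_cases h2 : R ≤ 2
  · refine ⟨k + ⌊lam / 20⌋₊ + 1, fun n hn T hT => ?_⟩
    obtain ⟨t, ht, f, hf⟩ := JuntaTesting.exists_two_le_numQueries (by omega) (by linarith)
      (by linarith) T hT
    exact ⟨t, ht, f, h2.trans (by exact_mod_cast hf)⟩
  -- From `x ≤ exp x` one gets `R ≤ exp (k / 2000000)`, so a smaller `k` would give `R ≤ 2`.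
  have hk6 : 1000000 ≤ (k : ℝ) := by
    by_contra! h
    apply h2
    calc R ≤ Real.exp ((k : ℝ) / lam) ^ (lam / 2000000) := by
          refine Real.rpow_le_rpow (by positivity) ?_ (by positivity)
          linarith [Real.add_one_le_exp ((k : ℝ) / lam)]
      _ = Real.exp ((k : ℝ) / 2000000) := by
          rw [← Real.exp_mul]; congr 1; field_simp
      _ ≤ Real.exp (1 / 2) := Real.exp_le_exp.2 (by linarith)
      _ ≤ 2 := by
          have h1 : Real.exp (1 / 2) ^ 2 = Real.exp 1 := by
            rw [← Real.exp_nat_mul]; norm_num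
          have := Real.exp_one_lt_d9
          nlinarith [Real.exp_pos (1 / 2)]
  have hlk : lam < k := by
    by_contra! h
    apply h2
    refine (Real.rpow_le_one (by positivity) ?_ (by positivity)).trans (by norm_num)
    exact div_le_one_of_le₀ h (by linarith)
  by_cases hbig : 800 ≤ lam
  · set r := ⌊lam / 100⌋₊ with hr
    have hr1 : (r : ℝ) ≤ lam / 100 := Nat.floor_le (by positivity)
    have hr2 : lam / 100 < r + 1 := Nat.lt_floor_add_one _
    have hr8 : 8 ≤ r := Nat.le_floor (by push_cast; linarith)
    have hr8' : (8 : ℝ) ≤ r := by exact_mod_cast hr8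
    refine ⟨k + 44 * r, fun n hn T hT => ?_⟩
    by_contra hno
    have hkr : 100 * r ≤ k := by
      have : (100 : ℝ) * r ≤ k := by linarith
      exact_mod_cast this
    have hmain := JuntaTesting.numQueries_lower_bound_of_small_gap hε₁ hlt hε₂ (r := r)
      (by omega) hkr (by
        rw [hgap, ← Real.rpow_natCast, ← Real.rpow_add two_pos]
        refine Real.rpow_le_one_of_one_le_of_nonpos (by norm_num) ?_
        push_cast
        linarith) (by
        have h3 : (⌊lam / 20⌋₊ : ℝ) ≤ lam / 20 := Nat.floor_le (by positivity)
        have h4 : ((⌊lam / 20⌋₊ : ℕ) : ℝ) ≤ ((5 * r + 5 : ℕ) : ℝ) := by push_cast; linarith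
        exact_mod_cast h4) hn T hT (of_bound T hno)
    have hdiv : 1 ≤ k / (88 * r) := by
      rw [Nat.one_le_div_iff (by omega)]
      omega
    have hdiv' : (k : ℝ) / lam ≤ ((k / (88 * r) : ℕ) : ℝ) + 1 := by
      have h3 : k < (k / (88 * r) + 1) * (88 * r) := by
        rw [mul_comm]
        exact Nat.lt_mul_div_succ k (by omega)
      have h4 : (k : ℝ) < (((k / (88 * r) : ℕ) : ℝ) + 1) * (88 * r) := by exact_mod_cast h3
      rw [div_le_iff₀ (by linarith)]
      refine h4.le.trans ?_
      gcongr
      linarith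
    have hy2 : (2 : ℝ) ≤ ((k / (88 * r) : ℕ) : ℝ) + 1 := by
      have : (1 : ℝ) ≤ ((k / (88 * r) : ℕ) : ℝ) := by exact_mod_cast hdiv
      linarith
    set y : ℝ := ((k / (88 * r) : ℕ) : ℝ) + 1 with hy
    -- With `u` the right side, the bound becomes `u ^ 8 ≤ 10 * u ^ 2`, which contradicts `u ≥ 2`.
    have hRu : R ≤ y ^ ((r : ℝ) / 8) := by
      calc R ≤ y ^ (lam / 2000000) :=
            Real.rpow_le_rpow (by positivity) hdiv' (by positivity)
        _ ≤ _ := Real.rpow_le_rpow_of_exponent_le (by linarith) (by linarith)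
    have hu8 : (y ^ ((r : ℝ) / 8)) ^ 8 = y ^ r := by
      rw [← Real.rpow_natCast, ← Real.rpow_mul (by linarith), ← Real.rpow_natCast y r]
      congr 1
      push_cast
      ring
    have hu2 : 2 ≤ y ^ ((r : ℝ) / 8) := by
      calc (2 : ℝ) ≤ y := hy2
        _ = y ^ (1 : ℝ) := (Real.rpow_one y).symm
        _ ≤ _ := Real.rpow_le_rpow_of_exponent_le (by linarith) (by linarith)
    rw [← hu8] at hmain
    set u := y ^ ((r : ℝ) / 8) with hu
    have h3 : R ^ 2 ≤ u ^ 2 := by gcongr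
    have h4 : (2 : ℝ) ^ 6 ≤ u ^ 6 := by gcongr
    have h5 : u ^ 8 = u ^ 6 * u ^ 2 := by ring
    nlinarith [sq_nonneg u]
  · push Not at hbig
    refine ⟨k + 60, fun n hn T hT => ?_⟩
    by_contra hno
    have hk6' : 1000000 ≤ k := by exact_mod_cast hk6
    have hmain := JuntaTesting.numQueries_lower_bound_of_large_gap hε₁ hε₂ (by omega) (by
        have h3 : (⌊lam / 20⌋₊ : ℝ) ≤ lam / 20 := Nat.floor_le (by positivity)
        have h4 : ((⌊lam / 20⌋₊ : ℕ) : ℝ) ≤ ((40 : ℕ) : ℝ) := by push_cast; linarith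
        exact_mod_cast h4) hn T hT (of_bound T hno)
    have hdiv : (k : ℝ) ≤ (((k / 60 : ℕ) : ℝ) + 1) * 60 := by
      have h3 : k ≤ (k / 60 + 1) * 60 := by omega
      exact_mod_cast h3
    -- The query bound would now give `k ≤ 600 * √k`, which fails for `k ≥ 1000000`.
    have hRu : R ≤ (k : ℝ) ^ ((1 : ℝ) / 4) := by
      calc R ≤ (k : ℝ) ^ (lam / 2000000) := by
            refine Real.rpow_le_rpow (by positivity) ?_ (by positivity)
            exact div_le_self hk0 hlam1.le
        _ ≤ _ := Real.rpow_le_rpow_of_exponent_le (by linarith) (by linarith)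
    have hu4 : ((k : ℝ) ^ ((1 : ℝ) / 4)) ^ 4 = k := by
      rw [← Real.rpow_natCast, ← Real.rpow_mul hk0]
      norm_num
    set u := (k : ℝ) ^ ((1 : ℝ) / 4) with hu
    have h3 : R ^ 2 ≤ u ^ 2 := by gcongr
    have h5 : u ^ 4 = u ^ 2 * u ^ 2 := by ring
    nlinarith [sq_nonneg u]
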